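/- **Corollary.** Let the ambient transmitters $\Phi$ be located at the points $\mathbf x_a$ of a homogeneous Poisson point process of spatial density $\zeta_A>0$ on $\mathbb R^2$. Each transmitter is active independently with probability $l_A\in(0,1]$ (the transmission load); let $\mathcal A$ be the set of active ones. The ambient fading gains $h_a$ are i.i.d. $\mathrm{Exp}(1)$ (Rayleigh fading), the gain $h_{\mathrm{S},\mathrm{D}}$ of the link from the hybrid transmitter, located at $\mathbf x_{\mathrm S}$, to its receiver, located at $\mathbf x_{\mathrm D}$, $d=\|\mathbf x_{\mathrm S}-\mathbf x_{\mathrm D}\|>0$, is exponential with rate $\lambda>0$, and locations, activity indicators, ambient gains and link gain are independent. The path-loss exponent is $\mu=4$. Let $$P_I=P_A\sum_{a\in\mathcal A}h_a\|\mathbf x_a-\mathbf x_{\mathrm S}\|^{-4},\qquad P_A>0,$$ be the incident power at the hybrid transmitter. Let $0<\beta\le1$, $0<\varrho<1$, $0<\omega<1$, $0<\delta\le 1$, $\sigma,\rho_{\mathrm B},\rho_{\mathrm H}>0$, $\tau_{\mathrm B}\ge0$; put $P_E^{\mathrm B}=\beta\varrho P_I$ and $P_E^{\mathrm H}=\omega\beta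 P_I$ (energy harvesting rates in ambient backscattering and in harvest-then-transmit mode), and let $\nu_{\mathrm B}=\delta P_I(1-\varrho)h_{\mathrm{S},\mathrm{D}}\,d^{-4}/\sigma^2$ if $P_E^{\mathrm B}>\rho_{\mathrm B}$ and $\nu_{\mathrm B}=0$ otherwise (the signal-to-noise ratio of the backscatter at the receiver). For a protocol that selects backscattering with probability $\mathcal B$, the energy outage probability is defined as $$\mathcal O=\mathcal B\,\mathbb P[P_E^{\mathrm B}\le\rho_{\mathrm B}]+(1-\mathcal B)\,\mathbb P[P_E^{\mathrm H}\le\rho_{\mathrm H}],$$ where $\mathcal B=\mathbb P[P_E^{\mathrm H}\le\rho_{\mathrm H}]$ for the power threshold-based protocol (PTP) and $\mathcal B=\mathbb P[\nu_{\mathrm B}>\tau_{\mathrm B},\,P_E^{\mathrm B}>\rho_{\mathrm B}]$ for the SNR threshold-based protocol (STP). Write $\zeta=l_A\zeta_A$ (so $\zeta=\zeta_A$ when all transmitters are active, $l_A=1$). Then the series $P_I$ converges almost surely; its law is concentrated on $(0,\infty)$ with density $$f_{P_I}(\rho)=\frac14\Big(\frac{\pi}{\rho}\Big)^{3/2}\zeta\sqrt{P_A}\,\exp\Big(-\frac{\pi^4\zeta^2P_A}{16\rho}\Big),\qquad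 \rho>0,$$ and its distribution function is $$F_{P_I}(\rho)=\mathrm{erfc}\Big(\frac{\zeta\sqrt{P_A}\,\pi^2}{4\sqrt\rho}\Big),\qquad \rho>0,\qquad \mathrm{erfc}(x)=\frac2{\sqrt\pi}\int_x^\infty e^{-t^2}\,dt.$$ With these $f_{P_I}$ and $F_{P_I}$, the energy outage probabilities under PTP and STP are $$\mathcal O_{\mathrm{PTP}}=F_{P_I}\Big(\frac{\rho_{\mathrm H}}{\omega\beta}\Big)\Big(F_{P_I}\Big(\frac{\rho_{\mathrm B}}{\beta\varrho}\Big)-F_{P_I}\Big(\frac{\rho_{\mathrm H}}{\omega\beta}\Big)+1\Big),$$ $$\mathcal O_{\mathrm{STP}}=\int_{\rho_{\mathrm B}/(\beta\varrho)}^\infty\exp\Big(-\frac{\lambda\tau_{\mathrm B}d^4\sigma^2}{\delta\rho(1-\varrho)}\Big)f_{P_I}(\rho)\,d\rho\;\Big(F_{P_I}\Big(\frac{\rho_{\mathrm B}}{\beta\varrho}\Big)-F_{P_I}\Big(\frac{\rho_{\mathrm H}}{\omega\beta}\Big)\Big)+F_{P_I}\Big(\frac{\rho_{\mathrm H}}{\omega\beta}\Big),$$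 where the integral converges absolutely. -/

import Mathlib

open MeasureTheory ProbabilityTheory Set
open scoped ENNReal NNReal

noncomputable section

namespace HybridD2D

/-- The Euclidean plane. -/
abbrev Plane : Type := EuclideanSpace ℝ (Fin 2)

variable {Ω : Type*} [MeasurableSpace Ω]

/-! ### Poisson point processes -/

/-- The number of points of the random collection `X 0, X 1, …` that lie in `B`. -/
def count {E : Type*} (X : ℕ → Ω → E) (B : Set E) (w : Ω) : ℕ∞ :=
  {a : ℕ | X a w ∈ B}.encard

/-- The random points `X 0, X 1, …` form a Poisson point process with intensity measure `Λ`: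
the number of points in a measurable set `B` of finite intensity is Poisson with mean `Λ B`, and
the numbers of points in finitely many disjoint measurable sets are independent. (The points of
a process of infinite total intensity, such as a homogeneous one on the plane, are almost surely
infinitely many, hence the enumeration by `ℕ`.) -/
structure IsPoissonProcess {E : Type*} [MeasurableSpace E] (X : ℕ → Ω → E) (Λ : Measure E)
    (Pr : Measure Ω) : Prop where
  measurable : ∀ a, Measurable (X a)
  count_law : ∀ B : Set E, MeasurableSet B → Λ B ≠ ∞ →
    HasLaw (count X B) ((poissonMeasure (Λ B).toNNReal).map (fun k : ℕ => (k : ℕ∞))) Pr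
  count_indep : ∀ (m : ℕ) (B : Fin m → Set E), (∀ i, MeasurableSet (B i)) →
    (∀ i j, i ≠ j → Disjoint (B i) (B j)) → iIndepFun (fun i => count X (B i)) Pr

/-! ### The network -/

/-- The probabilistic model. The locations `X a` of the ambient transmitters form a homogeneous
Poisson point process of spatial density `ζ` on the whole plane; the state indicators `c a` are
i.i.d., transmitter `a` being active with probability `l` (the transmission load); the fading
gains `h a` from the ambient transmitters are i.i.d. exponential of rate `1` (Rayleigh fading of
unit mean); the gain `g` of the link from the hybrid transmitter to its receiver is exponential
of rate `lam`; and locations, indicators, ambient gains and link gain are mutually independent. -/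
structure IsNetwork (X : ℕ → Ω → Plane) (c : ℕ → Ω → Bool) (h : ℕ → Ω → ℝ) (g : Ω → ℝ)
    (ζ l lam : ℝ) (Pr : Measure Ω) : Prop where
  poisson : IsPoissonProcess X (ENNReal.ofReal ζ • (volume : Measure Plane)) Pr
  measurable_c : ∀ a, Measurable (c a)
  load : ∀ a, Pr {w | c a w = true} = ENNReal.ofReal l
  indep_c : iIndepFun c Pr
  measurable_h : ∀ a, Measurable (h a)
  law_h : ∀ a, HasLaw (h a) (expMeasure 1) Pr
  indep_h : iIndepFun h Pr
  measurable_g : Measurable g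
  law_g : HasLaw g (expMeasure lam) Pr
  indep_X : IndepFun (fun w a => X a w) (fun w => ((fun a => c a w), (fun a => h a w), g w)) Pr
  indep_c_hg : IndepFun (fun w a => c a w) (fun w => ((fun a => h a w), g w)) Pr
  indep_h_g : IndepFun (fun w a => h a w) g Pr

/-- The contribution `h_a ‖x_a - x_S‖ ^ (-μ)` of transmitter `a` to the incident power at `xS`,
per unit of transmit power. -/
def receivedGain (μ : ℝ) (xS : Plane) (X : ℕ → Ω → Plane) (h : ℕ → Ω → ℝ) (w : Ω) (a : ℕ) : ℝ :=
  h a w * ‖X a w - xS‖ ^ (-μ)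

/-- The incident power `P_I = P_A ∑ h_a ‖x_a - x_S‖ ^ (-μ)`, summed over the active ambient
transmitters. -/
def incidentPower (PA μ : ℝ) (xS : Plane) (X : ℕ → Ω → Plane) (c : ℕ → Ω → Bool)
    (h : ℕ → Ω → ℝ) (w : Ω) : ℝ :=
  PA * ∑' a : {a : ℕ // c a w = true}, receivedGain μ xS X h w a

/-- Energy harvesting rate in ambient backscattering mode, `β ϱ P_I`. -/
def harvestB (β ϱ : ℝ) (PI : Ω → ℝ) (w : Ω) : ℝ := β * ϱ * PI w

/-- Energy harvesting rate in harvest-then-transmit mode, `ω β P_I`. -/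
def harvestH (ω β : ℝ) (PI : Ω → ℝ) (w : Ω) : ℝ := ω * β * PI w

open Classical in
/-- Power at the hybrid receiver of the backscatter from the hybrid transmitter at distance `d`:
`δ P_I (1 - ϱ) g d ^ (-μ)` if the energy harvested exceeds `ρB`, and `0` otherwise. -/
def backscatterPower (δ β ϱ ρB d μ : ℝ) (PI g : Ω → ℝ) (w : Ω) : ℝ :=
  if ρB < harvestB β ϱ PI w then δ * PI w * (1 - ϱ) * g w * d ^ (-μ) else 0

/-- Signal-to-noise ratio at the hybrid receiver in ambient backscattering mode, for noise of
standard deviation `σ`. -/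
def snrB (δ β ϱ ρB d μ σ : ℝ) (PI g : Ω → ℝ) (w : Ω) : ℝ :=
  backscatterPower δ β ϱ ρB d μ PI g w / σ ^ 2

/-- Probability that the power threshold-based protocol selects backscattering. -/
def selectPTP (ω β ρH : ℝ) (PI : Ω → ℝ) (Pr : Measure Ω) : ℝ :=
  Pr.real {w | harvestH ω β PI w ≤ ρH}

/-- Probability that the SNR threshold-based protocol selects backscattering. -/
def selectSTP (δ β ϱ ρB d μ σ τB : ℝ) (PI g : Ω → ℝ) (Pr : Measure Ω) : ℝ :=
  Pr.real {w | τB < snrB δ β ϱ ρB d μ σ PI g w ∧ ρB < harvestB β ϱ PI w}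

/-- The energy outage probability `B ℙ[P_E^B ≤ ρ_B] + (1 - B) ℙ[P_E^H ≤ ρ_H]` of a protocol that
selects backscattering with probability `B`. -/
def energyOutage (B ω β ϱ ρB ρH : ℝ) (PI : Ω → ℝ) (Pr : Measure Ω) : ℝ :=
  B * Pr.real {w | harvestB β ϱ PI w ≤ ρB} + (1 - B) * Pr.real {w | harvestH ω β PI w ≤ ρH}

/-! ### The explicit law -/

/-- The complementary error function `(2 / √π) ∫_x^∞ exp (-t ^ 2) dt`. -/
def erfc (x : ℝ) : ℝ := 2 / √Real.pi * ∫ t in Ioi x, Real.exp (-t ^ 2)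

/-- The density on `(0, ∞)`. -/
def pdfPI (ζ PA ρ : ℝ) : ℝ :=
  1 / 4 * (Real.pi / ρ) ^ (3 / 2 : ℝ) * ζ * √PA *
    Real.exp (-(Real.pi ^ 4 * ζ ^ 2 * PA / (16 * ρ)))

/-- The distribution function on `(0, ∞)`. -/
def cdfPI (ζ PA ρ : ℝ) : ℝ := erfc (ζ * √PA * Real.pi ^ 2 / (4 * √ρ))

end HybridD2D

end

/-! The Laplace functional of a Poisson process, applied to a process with independent marks, gives
the Laplace transform of the incident power: `E exp (-s P_I) = exp (-ζ ∫ ℓ / (1 + ℓ))`, where `ℓ x =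
s P_A ‖x - x_S‖ ^ (-4)` and `ζ = l_A ζ_A`. Since the exponent `4` is twice the dimension of the
plane, the radial integral has an arctangent as primitive, and the transform is `exp (-2 k √s)` with
`k = ζ √P_A π² / 4`. The Lévy density of scale `k` has the same transform, by an explicit primitive
in terms of `erfc`. The two laws coincide because the transform at the natural numbers determines a
finite measure on `[0, ∞]`: by Stone–Weierstrass, polynomials in `exp (-x)` are dense in the
continuous functions on this compact space. The link gain is independent of the incident power, so
that the selection probability of the SNR protocol is the integral of an exponential tail against
the Lévy law. -/

namespace HybridD2D

open Filter Topology
open scoped BoundedContinuousFunction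

noncomputable section

/-- The function `x ↦ exp (-x)` on `[0, ∞]`, with value `0` at `∞`: the integrand of Laplace
transforms of random variables that may be infinite. -/
def negExp (x : ℝ≥0∞) : ℝ≥0∞ := (EReal.exp x)⁻¹

@[simp] lemma negExp_zero : negExp 0 = 1 := by simp [negExp]

lemma negExp_ofReal {r : ℝ} (hr : 0 ≤ r) :
    negExp (ENNReal.ofReal r) = ENNReal.ofReal (Real.exp (-r)) := by
  rw [negExp, EReal.coe_ennreal_ofReal, max_eq_left hr, EReal.exp_coe,
    ← ENNReal.ofReal_inv_of_pos (Real.exp_pos r), Real.exp_neg]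

lemma negExp_add (x y : ℝ≥0∞) : negExp (x + y) = negExp x * negExp y := by
  rw [negExp, EReal.coe_ennreal_add, EReal.exp_add, negExp, negExp,
    ENNReal.mul_inv (by simp) (by simp)]

lemma negExp_sum {ι : Type*} (s : Finset ι) (f : ι → ℝ≥0∞) :
    negExp (∑ i ∈ s, f i) = ∏ i ∈ s, negExp (f i) := by
  classical
  induction s using Finset.induction_on with
  | empty => simp
  | insert i s hi ih => rw [Finset.sum_insert hi, Finset.prod_insert hi, negExp_add, ih]

lemma negExp_mul_natCast (x : ℝ≥0∞) (n : ℕ) : negExp (x * n) = negExp x ^ n := by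
  simpa [mul_comm] using negExp_sum (Finset.range n) fun _ => x

lemma negExp_strictAnti : StrictAnti negExp := fun x y h => by simpa [negExp] using h

lemma negExp_le_one (x : ℝ≥0∞) : negExp x ≤ 1 := by
  simpa using negExp_strictAnti.antitone (zero_le (a := x))

lemma negExp_ne_top (x : ℝ≥0∞) : negExp x ≠ ∞ :=
  ((negExp_le_one x).trans_lt ENNReal.one_lt_top).ne

lemma negExp_toENNReal_neg_log {x : ℝ≥0∞} (hx : x ≤ 1) :
    negExp (-ENNReal.log x).toENNReal = x := by
  rw [negExp, EReal.coe_toENNReal (by simpa using hx), EReal.exp_neg, ENNReal.exp_log, inv_inv]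

lemma continuous_negExp : Continuous negExp :=
  continuous_inv.comp (ENNReal.continuous_exp.comp continuous_coe_ennreal_ereal)

@[fun_prop]
lemma measurable_negExp : Measurable negExp := continuous_negExp.measurable

/-! ### Finite measures on `[0, ∞]` are determined by their Laplace transforms -/

/-- `negExp` as a bounded continuous real function: the generator of the point-separating algebra
to which the Stone–Weierstrass theorem is applied. -/
def negExpBCF : ℝ≥0∞ →ᵇ ℝ :=
  BoundedContinuousFunction.mkOfCompact
    ⟨fun x => (negExp x).toReal, ENNReal.continuousOn_toReal.comp_continuous continuous_negExp
      negExp_ne_top⟩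

lemma integral_negExpBCF_pow (μ : Measure ℝ≥0∞) (n : ℕ) :
    ∫ x, (negExpBCF ^ n) x ∂μ = (∫⁻ x, negExp (x * n) ∂μ).toReal := by
  rw [← integral_toReal (by fun_prop) (ae_of_all _ fun x => (negExp_ne_top _).lt_top)]
  simp [negExp_mul_natCast, negExpBCF]

theorem ext_of_lintegral_negExp_mul_natCast {μ ν : Measure ℝ≥0∞} [IsFiniteMeasure μ]
    [IsFiniteMeasure ν] (h : ∀ n : ℕ, ∫⁻ x, negExp (x * n) ∂μ = ∫⁻ x, negExp (x * n) ∂ν) :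
    μ = ν := by
  let A : StarSubalgebra ℝ (ℝ≥0∞ →ᵇ ℝ) :=
    { Algebra.adjoin ℝ {negExpBCF} with star_mem' := id }
  refine ext_of_forall_mem_subalgebra_integral_eq_of_polish (A := A) ?_ fun f hf => ?_
  · intro x y hxy
    refine ⟨fun x => (negExp x).toReal,
      ⟨_, ⟨negExpBCF, Algebra.self_mem_adjoin_singleton ℝ _, rfl⟩, rfl⟩, fun he => ?_⟩
    exact hxy (negExp_strictAnti.injective
      ((ENNReal.toReal_eq_toReal_iff' (negExp_ne_top _) (negExp_ne_top _)).1 he))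
  · change f ∈ Algebra.adjoin ℝ {negExpBCF} at hf
    rw [Algebra.adjoin_singleton_eq_range_aeval] at hf
    obtain ⟨p, rfl⟩ := hf
    change ∫ x, Polynomial.aeval negExpBCF p x ∂μ = ∫ x, Polynomial.aeval negExpBCF p x ∂ν
    simp only [Polynomial.aeval_eq_sum_range, BoundedContinuousFunction.coe_sum,
      Finset.sum_apply, BoundedContinuousFunction.coe_smul]
    rw [integral_finsetSum _ fun n _ => ((negExpBCF ^ n).integrable μ).fun_smul (p.coeff n),
      integral_finsetSum _ fun n _ => ((negExpBCF ^ n).integrable ν).fun_smul (p.coeff n)]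
    refine Finset.sum_congr rfl fun n _ => ?_
    rw [integral_smul, integral_smul, integral_negExpBCF_pow, integral_negExpBCF_pow, h]

lemma tendsto_lintegral_negExp {Ω : Type*} [MeasurableSpace Ω] {Pr : Measure Ω}
    [IsFiniteMeasure Pr] {u : ℕ → Ω → ℝ≥0∞} {v : Ω → ℝ≥0∞} (hu : ∀ n, Measurable (u n))
    (h : ∀ w, Tendsto (fun n => u n w) atTop (𝓝 (v w))) :
    Tendsto (fun n => ∫⁻ w, negExp (u n w) ∂Pr) atTop (𝓝 (∫⁻ w, negExp (v w) ∂Pr)) :=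
  tendsto_lintegral_of_dominated_convergence (fun _ => 1) (fun n => measurable_negExp.comp (hu n))
    (fun _ => ae_of_all _ fun _ => negExp_le_one _) (by simp)
    (ae_of_all _ fun w => (continuous_negExp.tendsto _).comp (h w))

lemma tendsto_lintegral_negExp_sum {Ω : Type*} [MeasurableSpace Ω] {Pr : Measure Ω}
    [IsFiniteMeasure Pr] {u : ℕ → Ω → ℝ≥0∞} (hu : ∀ a, Measurable (u a)) :
    Tendsto (fun n => ∫⁻ w, negExp (∑ a ∈ Finset.range n, u a w) ∂Pr) atTop
      (𝓝 (∫⁻ w, negExp (∑' a, u a w) ∂Pr)) :=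
  tendsto_lintegral_negExp (fun _ => Finset.measurable_sum _ fun a _ => hu a)
    fun _ => ENNReal.summable.hasSum.tendsto_sum_nat

lemma lintegral_negExp_poissonMeasure (r : ℝ≥0) (y : ℝ≥0∞) :
    ∫⁻ k : ℕ, negExp (y * k) ∂(poissonMeasure r) = negExp (r * (1 - negExp y)) := by
  set z : ℝ := (negExp y).toReal with hz
  have hz0 : 0 ≤ z := ENNReal.toReal_nonneg
  have hzy : negExp y = ENNReal.ofReal z := (ENNReal.ofReal_toReal (negExp_ne_top y)).symm
  have hz1 : z ≤ 1 := by
    rw [hz]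
    exact ENNReal.toReal_le_of_le_ofReal zero_le_one (by simpa using negExp_le_one y)
  have hseries : HasSum (fun k : ℕ => Real.exp (-r) * ((r * z) ^ k / k.factorial))
      (Real.exp (-r) * Real.exp (r * z)) := by
    rw [Real.exp_eq_exp_ℝ]
    exact (NormedSpace.expSeries_div_hasSum_exp (r * z : ℝ)).mul_left _
  have hmean : (r : ℝ≥0∞) * (1 - negExp y) = ENNReal.ofReal (r * (1 - z)) := by
    rw [hzy, ENNReal.ofReal_mul r.coe_nonneg, ENNReal.ofReal_coe_nnreal,
      ENNReal.ofReal_sub _ hz0, ENNReal.ofReal_one]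
  have hexp : Real.exp (-(r * (1 - z))) = Real.exp (-r) * Real.exp (r * z) := by
    rw [← Real.exp_add]
    ring_nf
  rw [lintegral_countable', hmean, negExp_ofReal (mul_nonneg r.coe_nonneg (by linarith)), hexp,
    ← hseries.tsum_eq, ENNReal.ofReal_tsum_of_nonneg (fun k => by positivity) hseries.summable]
  refine tsum_congr fun k => ?_
  rw [negExp_mul_natCast, hzy, ← ENNReal.ofReal_pow hz0, poissonMeasure_singleton,
    ← ENNReal.ofReal_mul (by positivity)]
  congr 1
  rw [mul_pow]
  ring

/-! ### The Laplace functional of a Poisson process -/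

section LaplaceFunctional

variable {Ω E : Type*} [MeasurableSpace E] {X : ℕ → Ω → E}

/-- The random counting measure `∑ₐ δ_{X a}`, through which sums over the points are integrals. -/
def pointMeasure (X : ℕ → Ω → E) (w : Ω) : Measure E := Measure.sum fun a => Measure.dirac (X a w)

lemma lintegral_pointMeasure (X : ℕ → Ω → E) (w : Ω) {f : E → ℝ≥0∞} (hf : Measurable f) :
    ∫⁻ x, f x ∂(pointMeasure X w) = ∑' a, f (X a w) := by
  rw [pointMeasure, lintegral_sum_measure]
  exact tsum_congr fun a => lintegral_dirac' _ hf

lemma pointMeasure_apply (X : ℕ → Ω → E) (w : Ω) {B : Set E} (hB : MeasurableSet B) :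
    pointMeasure X w B = (count X B w : ℝ≥0∞) := by
  rw [← lintegral_indicator_one hB, lintegral_pointMeasure X w (measurable_one.indicator hB),
    count, ← ENNReal.tsum_set_one, tsum_subtype {a | X a w ∈ B} (fun _ => (1 : ℝ≥0∞))]
  rfl

lemma exists_simpleFunc_finMeasSupp_tendsto (Λ : Measure E) [SigmaFinite Λ] {f : E → ℝ≥0∞}
    (hf : Measurable f) :
    ∃ F : ℕ → SimpleFunc E ℝ≥0∞, (∀ n, (F n).FinMeasSupp Λ) ∧ (∀ x, Monotone fun n => F n x) ∧
      ∀ x, Tendsto (fun n => F n x) atTop (𝓝 (f x)) := by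
  have happ : ∀ n x, (SimpleFunc.eapprox f n).restrict (spanningSets Λ n) x
      = (spanningSets Λ n).indicator (SimpleFunc.eapprox f n) x :=
    fun n x => SimpleFunc.restrict_apply _ (measurableSet_spanningSets Λ n) x
  refine ⟨fun n => (SimpleFunc.eapprox f n).restrict (spanningSets Λ n), fun n => ?_,
    fun x m n hmn => ?_, fun x => ?_⟩
  · refine SimpleFunc.finMeasSupp_iff_support.2
      ((measure_mono fun x hx => ?_).trans_lt (measure_spanningSets_lt_top Λ n))
    by_contra h
    exact hx (by rw [happ, indicator_of_notMem h])
  · simp only [happ]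
    exact (indicator_le_indicator (SimpleFunc.monotone_eapprox f hmn x)).trans
      (indicator_le_indicator_of_subset (monotone_spanningSets Λ hmn) (fun _ => zero_le) x)
  · refine (SimpleFunc.tendsto_eapprox hf x).congr' ?_
    filter_upwards [eventually_ge_atTop (spanningSetsIndex Λ x)] with n hn
    rw [happ, indicator_of_mem (monotone_spanningSets Λ hn (mem_spanningSetsIndex Λ x))]

variable [MeasurableSpace Ω] {Λ : Measure E} {Pr : Measure Ω}

lemma measurable_pointMeasure_apply (hX : ∀ a, Measurable (X a)) {B : Set E}
    (hB : MeasurableSet B) : Measurable fun w => pointMeasure X w B := by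
  have hsum : (fun w => pointMeasure X w B) = fun w => ∑' a, B.indicator 1 (X a w) := by
    ext w
    rw [← lintegral_indicator_one hB, lintegral_pointMeasure X w (measurable_one.indicator hB)]
  rw [hsum]
  exact Measurable.tsum fun a => (measurable_one.indicator hB).comp (hX a)

namespace IsPoissonProcess

lemma lintegral_negExp_count (hX : IsPoissonProcess X Λ Pr) {B : Set E} (hB : MeasurableSet B)
    (hΛ : Λ B ≠ ∞) (y : ℝ≥0∞) :
    ∫⁻ w, negExp (y * pointMeasure X w B) ∂Pr = negExp ((1 - negExp y) * Λ B) := by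
  simp_rw [pointMeasure_apply X _ hB]
  rw [(hX.count_law B hB hΛ).lintegral_comp (f := fun k : ℕ∞ => negExp (y * (k : ℝ≥0∞)))
    (by fun_prop), lintegral_map (by fun_prop) (by fun_prop)]
  simp only [ENat.toENNReal_coe]
  rw [lintegral_negExp_poissonMeasure, ENNReal.coe_toNNReal hΛ, mul_comm]

lemma iIndepFun_pointMeasure (hX : IsPoissonProcess X Λ Pr) {ι : Type*} [Finite ι]
    {B : ι → Set E} (hB : ∀ i, MeasurableSet (B i)) (hd : Pairwise (Function.onFun Disjoint B)) :
    iIndepFun (fun i w => pointMeasure X w (B i)) Pr := by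
  let e := Finite.equivFin ι
  have hcount := hX.count_indep (Nat.card ι) (fun i => B (e.symm i)) (fun i => hB _)
    (fun i j hij => hd (e.symm.injective.ne hij))
  have hcount_ennreal := (hcount.precomp e.injective).comp (mγ := fun _ => inferInstance)
    (fun _ k => (k : ℝ≥0∞)) (fun _ => by fun_prop)
  convert hcount_ennreal using 2 with i
  ext w
  simp [pointMeasure_apply X w (hB i), e]

lemma lintegral_negExp_simpleFunc [IsProbabilityMeasure Pr] (hX : IsPoissonProcess X Λ Pr)
    (f : SimpleFunc E ℝ≥0∞) (hf : f.FinMeasSupp Λ) :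
    ∫⁻ w, negExp (∑' a, f (X a w)) ∂Pr = negExp (∫⁻ x, (1 - negExp (f x)) ∂Λ) := by
  classical
  set s := f.range.filter (· ≠ 0)
  have hprod (w : Ω) : negExp (∑' a, f (X a w))
      = ∏ y : s, negExp (y * pointMeasure X w (f ⁻¹' {(y : ℝ≥0∞)})) := by
    rw [← lintegral_pointMeasure X w f.measurable, SimpleFunc.lintegral_eq_lintegral,
      SimpleFunc.lintegral, ← Finset.sum_filter_of_ne (p := (· ≠ 0)), negExp_sum,
      ← Finset.prod_coe_sort]
    intro y _ hy h0
    simp [h0] at hy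
  have hsum : ∫⁻ x, (1 - negExp (f x)) ∂Λ
      = ∑ y : s, (1 - negExp y) * Λ (f ⁻¹' {(y : ℝ≥0∞)}) := by
    have hmap := SimpleFunc.lintegral_eq_lintegral (f.map fun y => 1 - negExp y) Λ
    rw [SimpleFunc.map_lintegral] at hmap
    simp only [SimpleFunc.coe_map, Function.comp_apply] at hmap
    rw [hmap, ← Finset.sum_filter_of_ne (p := (· ≠ 0)), ← Finset.sum_coe_sort]
    intro y _ hy h0
    simp [h0] at hy
  have hdisj : Pairwise (Function.onFun Disjoint fun y : s => f ⁻¹' {(y : ℝ≥0∞)}) :=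
    fun y z hyz => Disjoint.preimage _ (disjoint_singleton.2 fun h => hyz (Subtype.ext h))
  have hfiber (y : s) : Λ (f ⁻¹' {(y : ℝ≥0∞)}) ≠ ∞ := by
    refine ((measure_mono fun x hx h0 => ?_).trans_lt
      (SimpleFunc.finMeasSupp_iff_support.1 hf)).ne
    exact (Finset.mem_filter.1 y.2).2 ((show f x = y from hx).symm.trans h0)
  have hindep := (hX.iIndepFun_pointMeasure (fun y : s => f.measurableSet_fiber y) hdisj).comp
    (fun y k => negExp (y * k)) (fun y => measurable_negExp.comp (by fun_prop))
  calc ∫⁻ w, negExp (∑' a, f (X a w)) ∂Pr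
      = ∏ y : s, ∫⁻ w, negExp (y * pointMeasure X w (f ⁻¹' {(y : ℝ≥0∞)})) ∂Pr := by
        simp_rw [hprod]
        exact lintegral_prod_eq_prod_lintegral_of_indepFun Finset.univ _ hindep
          fun y => measurable_negExp.comp
            ((measurable_pointMeasure_apply hX.measurable (f.measurableSet_fiber y)).const_mul _)
    _ = ∏ y : s, negExp ((1 - negExp y) * Λ (f ⁻¹' {(y : ℝ≥0∞)})) :=
        Finset.prod_congr rfl fun y _ =>
          hX.lintegral_negExp_count (f.measurableSet_fiber y) (hfiber y) y
    _ = negExp (∫⁻ x, (1 - negExp (f x)) ∂Λ) := by rw [hsum, negExp_sum]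

theorem lintegral_negExp_tsum [IsProbabilityMeasure Pr] [SigmaFinite Λ]
    (hX : IsPoissonProcess X Λ Pr) {f : E → ℝ≥0∞} (hf : Measurable f) :
    ∫⁻ w, negExp (∑' a, f (X a w)) ∂Pr = negExp (∫⁻ x, (1 - negExp (f x)) ∂Λ) := by
  obtain ⟨F, hFsupp, hFmono, hFlim⟩ := exists_simpleFunc_finMeasSupp_tendsto Λ hf
  have hL : Tendsto (fun n => ∫⁻ w, negExp (∑' a, F n (X a w)) ∂Pr) atTop
      (𝓝 (∫⁻ w, negExp (∑' a, f (X a w)) ∂Pr)) := by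
    refine tendsto_lintegral_negExp
      (fun n => Measurable.tsum fun a => (F n).measurable.comp (hX.measurable a)) fun w => ?_
    simp_rw [← lintegral_pointMeasure X w hf, ← lintegral_pointMeasure X w (F _).measurable]
    exact lintegral_tendsto_of_tendsto_of_monotone (fun n => (F n).measurable.aemeasurable)
      (ae_of_all _ hFmono) (ae_of_all _ hFlim)
  have hR : Tendsto (fun n => negExp (∫⁻ x, (1 - negExp (F n x)) ∂Λ)) atTop
      (𝓝 (negExp (∫⁻ x, (1 - negExp (f x)) ∂Λ))) := by
    refine (continuous_negExp.tendsto _).comp ?_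
    refine lintegral_tendsto_of_tendsto_of_monotone
      (fun n => ((measurable_negExp.comp (F n).measurable).const_sub 1).aemeasurable)
      (ae_of_all _ fun x m n hmn => tsub_le_tsub_left (negExp_strictAnti.antitone (hFmono x hmn)) 1)
      (ae_of_all _ fun x => ?_)
    exact ENNReal.Tendsto.sub tendsto_const_nhds
      ((continuous_negExp.tendsto _).comp (hFlim x)) (Or.inl ENNReal.one_ne_top)
  refine tendsto_nhds_unique hL (hR.congr fun n => ?_)
  exact (hX.lintegral_negExp_simpleFunc (F n) (hFsupp n)).symm

end IsPoissonProcess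

end LaplaceFunctional

/-! ### Independent marks -/

section Independence

variable {Ω S T R : Type*} [MeasurableSpace Ω] [MeasurableSpace S] [MeasurableSpace T]
  [MeasurableSpace R] {Pr : Measure Ω}

lemma iIndepFun_prodMk {ι : Type*} {f : ι → Ω → S} {g : ι → Ω → T} (hfm : ∀ i, Measurable (f i))
    (hgm : ∀ i, Measurable (g i)) (hf : iIndepFun f Pr) (hg : iIndepFun g Pr)
    (hfg : IndepFun (fun w i => f i w) (fun w i => g i w) Pr) :
    iIndepFun (fun i w => (f i w, g i w)) Pr := by
  refine iIndepSets.iIndep (fun i => ((hfm i).prodMk (hgm i)).comap_le) _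
    (fun i => isPiSystem_prod.comap fun w => (f i w, g i w))
    (fun i => by rw [← generateFrom_prod, MeasurableSpace.comap_generateFrom]; rfl) ?_
  rw [iIndepSets_iff]
  intro s C hC
  have hrect : ∀ i ∈ s, ∃ A B, MeasurableSet A ∧ MeasurableSet B ∧
      f i ⁻¹' A ∩ g i ⁻¹' B = C i := fun i hi => by
    obtain ⟨_, ⟨A, hA, B, hB, rfl⟩, hCi⟩ := hC i hi
    exact ⟨A, B, hA, hB, hCi⟩
  choose! A B hA hB hAB using hrect
  have hinter : ⋂ i ∈ s, C i = (fun w i => f i w) ⁻¹' (⋂ i ∈ s, Function.eval i ⁻¹' A i) ∩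
      (fun w i => g i w) ⁻¹' (⋂ i ∈ s, Function.eval i ⁻¹' B i) := by
    simp only [preimage_iInter, ← iInter_inter_distrib]
    exact iInter₂_congr fun i hi => (hAB i hi).symm
  rw [hinter, hfg.measure_inter_preimage_eq_mul _ _
    (s.measurableSet_biInter fun i hi => measurable_pi_apply i (hA i hi))
    (s.measurableSet_biInter fun i hi => measurable_pi_apply i (hB i hi))]
  simp only [preimage_iInter]
  refine (congr_arg₂ (· * ·) (hf.measure_inter_preimage_eq_mul s hA)
    (hg.measure_inter_preimage_eq_mul s hB)).trans (Finset.prod_mul_distrib.symm.trans ?_)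
  refine Finset.prod_congr rfl fun i hi => ?_
  have hfgi : IndepFun (f i) (g i) Pr := hfg.comp (measurable_pi_apply i) (measurable_pi_apply i)
  rw [← hAB i hi, hfgi.measure_inter_preimage_eq_mul _ _ (hA i hi) (hB i hi)]

variable [IsProbabilityMeasure Pr]

lemma lintegral_comp_of_indepFun {U : Ω → S} {V : Ω → T} (hU : Measurable U) (hV : Measurable V)
    (hUV : IndepFun U V Pr) {G : S → T → ℝ≥0∞} (hG : Measurable (Function.uncurry G)) :
    ∫⁻ w, G (U w) (V w) ∂Pr = ∫⁻ w, ∫⁻ w', G (U w) (V w') ∂Pr ∂Pr := by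
  have h := (indepFun_iff_map_prod_eq_prod_map_map hU.aemeasurable hV.aemeasurable).1 hUV
  have := Measure.isProbabilityMeasure_map (μ := Pr) hV.aemeasurable
  calc ∫⁻ w, G (U w) (V w) ∂Pr = ∫⁻ p, Function.uncurry G p ∂(Pr.map fun w => (U w, V w)) :=
        (lintegral_map hG (hU.prodMk hV)).symm
    _ = ∫⁻ u, ∫⁻ v, Function.uncurry G (u, v) ∂(Pr.map V) ∂(Pr.map U) := by
        rw [h, lintegral_prod _ hG.aemeasurable]
    _ = ∫⁻ w, ∫⁻ w', G (U w) (V w') ∂Pr ∂Pr := by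
        rw [lintegral_map hG.lintegral_prod_right' hU]
        exact lintegral_congr fun w => lintegral_map (hG.comp measurable_prodMk_left) hV

lemma indepFun_prodMk_left {U : Ω → S} {V : Ω → T} {W : Ω → R} (hU : Measurable U)
    (hV : Measurable V) (hW : Measurable W) (h : IndepFun U (fun w => (V w, W w)) Pr)
    (h' : IndepFun V W Pr) : IndepFun (fun w => (U w, V w)) W Pr := by
  have hUVW := (indepFun_iff_map_prod_eq_prod_map_map hU.aemeasurable
    (hV.prodMk hW).aemeasurable).1 h
  have hVW := (indepFun_iff_map_prod_eq_prod_map_map hV.aemeasurable hW.aemeasurable).1 h'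
  have hUV : Pr.map (fun w => (U w, V w)) = _ :=
    (indepFun_iff_map_prod_eq_prod_map_map hU.aemeasurable hV.aemeasurable).1
      (h.comp measurable_id measurable_fst)
  have := Measure.isProbabilityMeasure_map (μ := Pr) hU.aemeasurable
  have := Measure.isProbabilityMeasure_map (μ := Pr) hV.aemeasurable
  have := Measure.isProbabilityMeasure_map (μ := Pr) hW.aemeasurable
  rw [indepFun_iff_map_prod_eq_prod_map_map (hU.prodMk hV).aemeasurable hW.aemeasurable]
  calc Pr.map (fun w => ((U w, V w), W w))
      = (Pr.map fun w => (U w, (V w, W w))).map MeasurableEquiv.prodAssoc.symm := by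
        rw [Measure.map_map (MeasurableEquiv.measurable _) (hU.prodMk (hV.prodMk hW))]
        rfl
    _ = (Pr.map fun w => (U w, V w)).prod (Pr.map W) := by
        rw [hUVW, hVW, hUV, ← Measure.prodAssoc_prod, MeasurableEquiv.map_symm_map]

lemma lintegral_prod_comp_mark {E : Type*} [MeasurableSpace E] {X : ℕ → Ω → E} {M : ℕ → Ω → S}
    {ν : Measure S} (hXm : ∀ a, Measurable (X a)) (hMm : ∀ a, Measurable (M a))
    (hM : ∀ a, HasLaw (M a) ν Pr) (hMi : iIndepFun M Pr)
    (hXM : IndepFun (fun w a => X a w) (fun w a => M a w) Pr) {q : E → S → ℝ≥0∞}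
    (hq : Measurable (Function.uncurry q)) (s : Finset ℕ) :
    ∫⁻ w, ∏ a ∈ s, q (X a w) (M a w) ∂Pr = ∫⁻ w, ∏ a ∈ s, ∫⁻ m, q (X a w) m ∂ν ∂Pr := by
  have hqx (x : E) : Measurable (q x) := hq.comp measurable_prodMk_left
  rw [lintegral_comp_of_indepFun (G := fun x m => ∏ a ∈ s, q (x a) (m a))
    (measurable_pi_lambda _ hXm) (measurable_pi_lambda _ hMm) hXM
    (Finset.measurable_prod _ fun a _ => hq.comp (g := Function.uncurry q)
      (f := fun p : (ℕ → E) × (ℕ → S) => (p.1 a, p.2 a)) (by fun_prop))]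
  refine lintegral_congr fun w => ?_
  rw [lintegral_prod_eq_prod_lintegral_of_indepFun s (fun a w' => q (X a w) (M a w'))
    (hMi.comp _ fun a => hqx _) fun a => (hqx _).comp (hMm a)]
  exact Finset.prod_congr rfl fun a _ => (hM a).lintegral_comp (hqx _).aemeasurable

end Independence

/-- The marked sum has the same transform as the sum over the points of the function
`F x = -log ∫ exp (-f x m) dν(m)`, since the two agree for finitely many terms. -/
theorem IsPoissonProcess.lintegral_negExp_tsum_mark {Ω E S : Type*} [MeasurableSpace Ω]
    [MeasurableSpace E] [MeasurableSpace S] {Pr : Measure Ω} [IsProbabilityMeasure Pr]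
    {X : ℕ → Ω → E} {Λ : Measure E} [SigmaFinite Λ] (hX : IsPoissonProcess X Λ Pr)
    {M : ℕ → Ω → S} {ν : Measure S} (hMm : ∀ a, Measurable (M a))
    (hM : ∀ a, HasLaw (M a) ν Pr) (hMi : iIndepFun M Pr)
    (hXM : IndepFun (fun w a => X a w) (fun w a => M a w) Pr) {f : E → S → ℝ≥0∞}
    (hf : Measurable (Function.uncurry f)) :
    ∫⁻ w, negExp (∑' a, f (X a w) (M a w)) ∂Pr
      = negExp (∫⁻ x, (1 - ∫⁻ m, negExp (f x m) ∂ν) ∂Λ) := by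
  have : IsProbabilityMeasure ν := (hM 0).isProbabilityMeasure_iff.1 inferInstance
  have hnegf : Measurable (Function.uncurry fun x m => negExp (f x m)) := measurable_negExp.comp hf
  set φ : E → ℝ≥0∞ := fun x => ∫⁻ m, negExp (f x m) ∂ν
  have hφ1 (x : E) : φ x ≤ 1 := (lintegral_mono fun m => negExp_le_one _).trans_eq (by simp)
  set F : E → ℝ≥0∞ := fun x => (-ENNReal.log (φ x)).toENNReal
  have hF : Measurable F :=
    (ENNReal.measurable_log.comp hnegf.lintegral_prod_right').neg.ereal_toENNReal
  have hnegF (x : E) : negExp (F x) = φ x := negExp_toENNReal_neg_log (hφ1 x)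
  have hfin (n : ℕ) : ∫⁻ w, negExp (∑ a ∈ Finset.range n, F (X a w)) ∂Pr
      = ∫⁻ w, negExp (∑ a ∈ Finset.range n, f (X a w) (M a w)) ∂Pr := by
    simp only [negExp_sum, hnegF]
    exact (lintegral_prod_comp_mark hX.measurable hMm hM hMi hXM hnegf _).symm
  have hF_lim := tendsto_lintegral_negExp_sum (Pr := Pr) fun a => hF.comp (hX.measurable a)
  have hf_lim := tendsto_lintegral_negExp_sum (Pr := Pr)
    fun a => hf.comp ((hX.measurable a).prodMk (hMm a))
  calc ∫⁻ w, negExp (∑' a, f (X a w) (M a w)) ∂Pr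
      = ∫⁻ w, negExp (∑' a, F (X a w)) ∂Pr :=
        tendsto_nhds_unique hf_lim (hF_lim.congr hfin)
    _ = negExp (∫⁻ x, (1 - φ x) ∂Λ) := by
        simp_rw [hX.lintegral_negExp_tsum hF, hnegF]

/-! ### The marks of the ambient transmitters -/

lemma lintegral_negExp_expMeasure {rate r : ℝ} (hrate : 0 < rate) (hr : 0 ≤ r) :
    ∫⁻ y, negExp (ENNReal.ofReal (y * r)) ∂(expMeasure rate)
      = ENNReal.ofReal (rate / (rate + r)) := by
  have h (y : ℝ) : exponentialPDF rate y * negExp (ENNReal.ofReal (y * r))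
      = ENNReal.ofReal (rate / (rate + r)) * exponentialPDF (rate + r) y := by
    rcases lt_or_ge y 0 with hy | hy
    · rw [exponentialPDF_of_neg hy, exponentialPDF_of_neg hy, zero_mul, mul_zero]
    · rw [exponentialPDF_of_nonneg hy, exponentialPDF_of_nonneg hy,
        negExp_ofReal (mul_nonneg hy hr), ← ENNReal.ofReal_mul (by positivity),
        ← ENNReal.ofReal_mul (by positivity), mul_assoc, ← Real.exp_add]
      congr 1
      field_simp
      ring_nf
  have hm (q : ℝ) : Measurable (exponentialPDF q) :=
    (measurable_exponentialPDFReal q).ennreal_ofReal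
  change ∫⁻ y, negExp (ENNReal.ofReal (y * r)) ∂(volume.withDensity (exponentialPDF rate)) = _
  rw [lintegral_withDensity_eq_lintegral_mul _ (hm rate) (by fun_prop)]
  simp only [Pi.mul_apply, h]
  rw [lintegral_const_mul _ (hm _), lintegral_exponentialPDF_eq_one (by positivity), mul_one]

lemma lintegral_bernoulliMeasure (p : unitInterval) (f : Bool → ℝ≥0∞) :
    ∫⁻ b, f b ∂(bernoulliMeasure true false p)
      = ENNReal.ofReal p * f true + ENNReal.ofReal (1 - p) * f false := by
  rw [bernoulliMeasure_def, lintegral_add_measure, lintegral_smul_measure, lintegral_smul_measure,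
    lintegral_dirac, lintegral_dirac, ENNReal.ofReal_eq_coe_nnreal (unitInterval.nonneg p),
    ENNReal.ofReal_eq_coe_nnreal (unitInterval.one_minus_nonneg p)]
  rfl

lemma hasLaw_bernoulliMeasure {Ω : Type*} [MeasurableSpace Ω] {Pr : Measure Ω}
    [IsProbabilityMeasure Pr] {b : Ω → Bool} (hb : Measurable b) {p : unitInterval}
    (h : Pr {w | b w = true} = ENNReal.ofReal p) :
    HasLaw b (bernoulliMeasure true false p) Pr := by
  refine ⟨hb.aemeasurable, Measure.ext fun s hs => ?_⟩
  have htrue : MeasurableSet {w | b w = true} := hb (measurableSet_singleton true)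
  have hfalse : Pr {w | b w = true}ᶜ = ENNReal.ofReal (1 - p) := by
    rw [prob_compl_eq_one_sub htrue, h, ENNReal.ofReal_sub _ (unitInterval.nonneg p),
      ENNReal.ofReal_one]
  rw [← lintegral_indicator_one hs, ← lintegral_indicator_one hs, lintegral_bernoulliMeasure,
    lintegral_map (by fun_prop) hb, ← lintegral_add_compl _ htrue, ← h, ← hfalse]
  have htrue_eq : ∫⁻ w in {w | b w = true}, s.indicator 1 (b w) ∂Pr
      = ∫⁻ _ in {w | b w = true}, s.indicator 1 true ∂Pr :=
    setLIntegral_congr_fun htrue fun w hw => by rw [show b w = true from hw]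
  have hfalse_eq : ∫⁻ w in {w | b w = true}ᶜ, s.indicator 1 (b w) ∂Pr
      = ∫⁻ _ in {w | b w = true}ᶜ, s.indicator 1 false ∂Pr :=
    setLIntegral_congr_fun htrue.compl fun w hw => by rw [Bool.eq_false_iff.2 hw]
  rw [htrue_eq, hfalse_eq, setLIntegral_const, setLIntegral_const, mul_comm,
    mul_comm (s.indicator 1 false)]

lemma measurable_ite_eq_true {S : Type*} [MeasurableSpace S] {b : S → Bool} {u : S → ℝ≥0∞}
    (hb : Measurable b) (hu : Measurable u) :
    Measurable fun p => if b p = true then u p else 0 :=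
  Measurable.ite (hb (measurableSet_singleton true)) hu measurable_const

lemma lintegral_negExp_mark (p : unitInterval) {r : ℝ} (hr : 0 ≤ r) :
    ∫⁻ m, negExp (if m.1 = true then ENNReal.ofReal (m.2 * r) else 0)
        ∂((bernoulliMeasure true false p).prod (expMeasure 1))
      = 1 - ENNReal.ofReal (p * (r / (1 + r))) := by
  have := isProbabilityMeasure_expMeasure one_pos
  have hm : Measurable fun m : Bool × ℝ =>
      negExp (if m.1 = true then ENNReal.ofReal (m.2 * r) else 0) :=
    measurable_negExp.comp (measurable_ite_eq_true measurable_fst (by fun_prop))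
  rw [lintegral_prod _ hm.aemeasurable, lintegral_bernoulliMeasure]
  simp only [if_true, Bool.false_eq_true, if_false, negExp_zero, lintegral_one, measure_univ,
    lintegral_negExp_expMeasure one_pos hr]
  have hp := unitInterval.nonneg p
  rw [mul_one, ← ENNReal.ofReal_mul (unitInterval.nonneg p),
    ← ENNReal.ofReal_add (by positivity) (unitInterval.one_minus_nonneg p), ← ENNReal.ofReal_one,
    ← ENNReal.ofReal_sub _ (by positivity)]
  congr 1
  field_simp
  ring

namespace IsNetwork

variable {Ω : Type*} [MeasurableSpace Ω] {Pr : Measure Ω} [IsProbabilityMeasure Pr]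
  {X : ℕ → Ω → Plane} {c : ℕ → Ω → Bool} {h : ℕ → Ω → ℝ} {g : Ω → ℝ} {ζ l lam : ℝ}

lemma load_le_one (hnet : IsNetwork X c h g ζ l lam Pr) : l ≤ 1 :=
  ENNReal.ofReal_le_one.1 ((hnet.load 0).symm.trans_le prob_le_one)

theorem lintegral_negExp_tsum_active (hnet : IsNetwork X c h g ζ l lam Pr) (hl : 0 ≤ l)
    {ℓ : Plane → ℝ} (hℓ : Measurable ℓ) (hℓ0 : ∀ x, 0 ≤ ℓ x) :
    ∫⁻ w, negExp (∑' a, if c a w = true then ENNReal.ofReal (h a w * ℓ (X a w)) else 0) ∂Pr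
      = negExp (ENNReal.ofReal ζ * ∫⁻ x, ENNReal.ofReal (l * (ℓ x / (1 + ℓ x)))) := by
  have hl1 := hnet.load_le_one
  have : SigmaFinite (ENNReal.ofReal ζ • (volume : Measure Plane)) :=
    inferInstanceAs (SigmaFinite (ζ.toNNReal • (volume : Measure Plane)))
  have hch : IndepFun (fun w a => c a w) (fun w a => h a w) Pr :=
    hnet.indep_c_hg.comp measurable_id measurable_fst
  have hlaw (a : ℕ) : HasLaw (fun w => (c a w, h a w))
      ((bernoulliMeasure true false ⟨l, hl, hl1⟩).prod (expMeasure 1)) Pr :=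
    (hch.comp (measurable_pi_apply a) (measurable_pi_apply a)).hasLaw_prod
      (hasLaw_bernoulliMeasure (hnet.measurable_c a) (hnet.load a)) (hnet.law_h a)
  have hXM : IndepFun (fun w a => X a w) (fun w a => (c a w, h a w)) Pr :=
    hnet.indep_X.comp (ψ := fun m : (ℕ → Bool) × (ℕ → ℝ) × ℝ => fun a => (m.1 a, m.2.1 a))
      measurable_id (by fun_prop)
  have hf : Measurable (Function.uncurry fun (x : Plane) (m : Bool × ℝ) =>
      if m.1 = true then ENNReal.ofReal (m.2 * ℓ x) else 0) :=
    measurable_ite_eq_true (by fun_prop) (by fun_prop)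
  rw [hnet.poisson.lintegral_negExp_tsum_mark
    (fun a => (hnet.measurable_c a).prodMk (hnet.measurable_h a)) hlaw
    (iIndepFun_prodMk hnet.measurable_c hnet.measurable_h hnet.indep_c hnet.indep_h hch) hXM hf]
  simp only [lintegral_negExp_mark _ (hℓ0 _), lintegral_smul_measure, smul_eq_mul]
  congr 2
  refine lintegral_congr fun x => ENNReal.sub_sub_cancel ENNReal.one_ne_top ?_
  have := hℓ0 x
  rw [ENNReal.ofReal_le_one]
  exact mul_le_one₀ hl1 (by positivity) (div_le_one_of_le₀ (by linarith) (by positivity))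

end IsNetwork

/-! ### The path gain of critical exponent -/

section PathGain

lemma hasDerivAt_arctan_pow_div_sqrt {n : ℕ} (hn : n ≠ 0) {t : ℝ} (ht : 0 < t) (r : ℝ) :
    HasDerivAt (fun r => √t / n * Real.arctan (r ^ n / √t))
      (r ^ (n - 1) * (t / (r ^ (2 * n) + t))) r := by
  have : 0 < √t := Real.sqrt_pos.2 ht
  have hn' : (n : ℝ) ≠ 0 := Nat.cast_ne_zero.2 hn
  refine (((hasDerivAt_pow n r).div_const √t).arctan.const_mul (√t / n)).congr_deriv ?_
  have hsum : 0 < r ^ (2 * n) + t := by rw [mul_comm, pow_mul]; positivity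
  rw [div_pow, ← pow_mul, mul_comm n 2, Real.sq_sqrt ht.le,
    show 1 + r ^ (2 * n) / t = (r ^ (2 * n) + t) / t by field_simp; ring]
  field_simp

lemma tendsto_arctan_pow_div_sqrt {n : ℕ} (hn : n ≠ 0) {t : ℝ} (ht : 0 < t) :
    Tendsto (fun r => √t / n * Real.arctan (r ^ n / √t)) atTop
      (𝓝 (√t / n * (Real.pi / 2))) :=
  ((tendsto_nhds_of_tendsto_nhdsWithin Real.tendsto_arctan_atTop).comp
    ((tendsto_pow_atTop hn).atTop_div_const (Real.sqrt_pos.2 ht))).const_mul _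

variable {E : Type*} [NormedAddCommGroup E] [NormedSpace ℝ E] [FiniteDimensional ℝ E]
  [Nontrivial E] [MeasurableSpace E] [BorelSpace E]

lemma lintegral_div_norm_pow_add (μ : Measure E) [μ.IsAddHaarMeasure] {t : ℝ} (ht : 0 < t) :
    ∫⁻ x, ENNReal.ofReal (t / (‖x‖ ^ (2 * Module.finrank ℝ E) + t)) ∂μ
      = ENNReal.ofReal (μ.real (Metric.ball 0 1) * (√t * (Real.pi / 2))) := by
  set D := Module.finrank ℝ E with hD
  have hD0 : D ≠ 0 := Module.finrank_pos.ne'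
  have hderiv (r : ℝ) (_ : r ∈ Ici 0) := hasDerivAt_arctan_pow_div_sqrt hD0 ht r
  have hnonneg (r : ℝ) (hr : r ∈ Ioi 0) : 0 ≤ r ^ (D - 1) * (t / (r ^ (2 * D) + t)) := by
    have : 0 < r := hr
    positivity
  have hint : Integrable (fun x : E => t / (‖x‖ ^ (2 * D) + t)) μ := by
    rw [integrable_fun_norm_addHaar μ (f := fun r => t / (r ^ (2 * D) + t))]
    exact integrableOn_Ioi_deriv_of_nonneg' hderiv hnonneg (tendsto_arctan_pow_div_sqrt hD0 ht)
  rw [← ofReal_integral_eq_lintegral_ofReal hint (ae_of_all _ fun x => by positivity),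
    integral_fun_norm_addHaar μ (fun r => t / (r ^ (2 * D) + t))]
  simp only [smul_eq_mul, nsmul_eq_mul, ← hD]
  rw [integral_Ioi_of_hasDerivAt_of_nonneg' hderiv hnonneg (tendsto_arctan_pow_div_sqrt hD0 ht)]
  congr 1
  simp only [zero_pow hD0, zero_div, Real.arctan_zero, mul_zero, sub_zero]
  field_simp

lemma lintegral_pathGain_div_one_add {t : ℝ} (ht : 0 ≤ t) (xS : Plane) :
    ∫⁻ x, ENNReal.ofReal (t * ‖x - xS‖ ^ (-4 : ℝ) / (1 + t * ‖x - xS‖ ^ (-4 : ℝ)))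
      = ENNReal.ofReal (Real.pi ^ 2 * √t / 2) := by
  rcases ht.eq_or_lt with rfl | ht
  · simp
  rw [lintegral_sub_right_eq_self
    (fun x : Plane => ENNReal.ofReal (t * ‖x‖ ^ (-4 : ℝ) / (1 + t * ‖x‖ ^ (-4 : ℝ)))) xS]
  have hball : (volume : Measure Plane).real (Metric.ball 0 1) = Real.pi := by
    simp [measureReal_def, EuclideanSpace.volume_ball_fin_two, Real.pi_pos.le]
  have hplane := lintegral_div_norm_pow_add (volume : Measure Plane) ht
  rw [finrank_euclideanSpace_fin, hball] at hplane
  convert hplane using 1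
  · refine lintegral_congr_ae ?_
    filter_upwards [compl_mem_ae_iff.2 (measure_singleton (0 : Plane))] with x hx
    have hx : 0 < ‖x‖ := norm_pos_iff.2 hx
    have hpow : ‖x‖ ^ (-4 : ℝ) = (‖x‖ ^ (2 * 2))⁻¹ := by
      rw [Real.rpow_neg hx.le]
      norm_cast
    rw [hpow]
    congr 1
    field_simp
  · congr 1
    ring

end PathGain

/-! ### The complementary error function -/

section Erfc

lemma integrable_exp_neg_sq : Integrable fun t : ℝ => Real.exp (-t ^ 2) := by
  simpa using integrable_exp_neg_mul_sq one_pos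

lemma integral_Ioi_exp_neg_sq : ∫ t in Ioi (0 : ℝ), Real.exp (-t ^ 2) = √Real.pi / 2 := by
  simpa using integral_gaussian_Ioi 1

lemma erfc_eq_one_sub (x : ℝ) :
    erfc x = 1 - 2 / √Real.pi * ∫ t in (0 : ℝ)..x, Real.exp (-t ^ 2) := by
  have hsplit := intervalIntegral.integral_interval_add_Ioi
    (integrable_exp_neg_sq.integrableOn (s := Ioi 0))
    (integrable_exp_neg_sq.integrableOn (s := Ioi x))
  rw [integral_Ioi_exp_neg_sq] at hsplit
  rw [erfc, eq_sub_iff_add_eq, ← mul_add, add_comm, hsplit]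
  field_simp

lemma hasDerivAt_erfc (x : ℝ) : HasDerivAt erfc (-(2 / √Real.pi * Real.exp (-x ^ 2))) x := by
  have hcont : Continuous fun t : ℝ => Real.exp (-t ^ 2) := by fun_prop
  have hderiv :=
    ((hcont.integral_hasStrictDerivAt 0 x).hasDerivAt.const_mul (2 / √Real.pi)).const_sub 1
  exact hderiv.congr_of_eventuallyEq (Eventually.of_forall erfc_eq_one_sub)

lemma erfc_zero : erfc 0 = 1 := by simp [erfc_eq_one_sub]

lemma erfc_neg (x : ℝ) : erfc (-x) = 2 - erfc x := by
  have hodd := intervalIntegral.integral_comp_neg (a := 0) (b := x)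
    fun t : ℝ => Real.exp (-t ^ 2)
  simp only [neg_sq, neg_zero] at hodd
  rw [erfc_eq_one_sub, erfc_eq_one_sub x, hodd, intervalIntegral.integral_symm]
  ring

lemma tendsto_erfc_atTop : Tendsto erfc atTop (𝓝 0) := by
  have hlim := ((intervalIntegral_tendsto_integral_Ioi 0
    (integrable_exp_neg_sq.integrableOn (s := Ioi 0)) tendsto_id).const_mul
      (2 / √Real.pi)).const_sub 1
  have hzero : 1 - 2 / √Real.pi * (√Real.pi / 2) = 0 := by
    field_simp
    simp
  rw [integral_Ioi_exp_neg_sq, hzero] at hlim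
  exact hlim.congr fun x => (erfc_eq_one_sub x).symm

lemma tendsto_erfc_atBot : Tendsto erfc atBot (𝓝 2) := by
  have hlim := (tendsto_erfc_atTop.comp tendsto_neg_atBot_atTop).const_sub 2
  rw [sub_zero] at hlim
  exact hlim.congr fun x => by simp [erfc_neg]

end Erfc

/-! ### The Lévy law -/

section LevyPrimitive

/-- The density on `(0, ∞)` of the Lévy distribution, with the scale `k` normalized so that the
Laplace transform is `s ↦ exp (-2 * k * √s)`; the usual scale parameter is `2 * k ^ 2`. -/
def levyPDF (k ρ : ℝ) : ℝ := k / (√Real.pi * (ρ * √ρ)) * Real.exp (-(k ^ 2 / ρ))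

lemma levyPDF_nonneg {k : ℝ} (hk : 0 ≤ k) {ρ : ℝ} (hρ : 0 ≤ ρ) : 0 ≤ levyPDF k ρ := by
  unfold levyPDF
  positivity

@[fun_prop]
lemma measurable_levyPDF (k : ℝ) : Measurable (levyPDF k) := by
  unfold levyPDF
  fun_prop

/-- The building block of `levyPrimitive`: its derivative is `exp (-q ^ 2 * ρ) * levyPDF k ρ` up to
a term which is odd in `q`, and so disappears in the mean over `q` and `-q`. -/
def erfcTilt (k q ρ : ℝ) : ℝ := Real.exp (2 * k * q) * erfc (k / √ρ + q * √ρ)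

lemma exp_mul_exp_neg_sq (k q : ℝ) {ρ : ℝ} (hρ : 0 < ρ) :
    Real.exp (2 * k * q) * Real.exp (-(k / √ρ + q * √ρ) ^ 2)
      = Real.exp (-(q ^ 2 * ρ)) * Real.exp (-(k ^ 2 / ρ)) := by
  have : 0 < √ρ := Real.sqrt_pos.2 hρ
  have hsq : (k / √ρ + q * √ρ) ^ 2 = k ^ 2 / √ρ ^ 2 + 2 * k * q + q ^ 2 * √ρ ^ 2 := by
    field_simp
    ring
  rw [← Real.exp_add, ← Real.exp_add, hsq, Real.sq_sqrt hρ.le]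
  congr 1
  ring

lemma hasDerivAt_erfcTilt (k q : ℝ) {ρ : ℝ} (hρ : 0 < ρ) :
    HasDerivAt (erfcTilt k q) (Real.exp (-(q ^ 2 * ρ)) *
      (levyPDF k ρ - q / (√Real.pi * √ρ) * Real.exp (-(k ^ 2 / ρ)))) ρ := by
  have hsqrt : 0 < √ρ := Real.sqrt_pos.2 hρ
  have hderiv_sqrt := Real.hasDerivAt_sqrt hρ.ne'
  have hderiv := (((hasDerivAt_erfc _).comp ρ
    (((hasDerivAt_const ρ k).div hderiv_sqrt hsqrt.ne').add
      (hderiv_sqrt.const_mul q))).const_mul (Real.exp (2 * k * q)))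
  refine hderiv.congr_deriv ?_
  simp only [Pi.add_apply, Pi.div_apply]
  calc Real.exp (2 * k * q) * (-(2 / √Real.pi * Real.exp (-(k / √ρ + q * √ρ) ^ 2)) *
        ((0 * √ρ - k * (1 / (2 * √ρ))) / √ρ ^ 2 + q * (1 / (2 * √ρ))))
    _ = Real.exp (2 * k * q) * Real.exp (-(k / √ρ + q * √ρ) ^ 2) *
        (k / (√Real.pi * (√ρ ^ 2 * √ρ)) - q / (√Real.pi * √ρ)) := by
      field_simp
      ring
    _ = Real.exp (-(q ^ 2 * ρ)) *
        (levyPDF k ρ - q / (√Real.pi * √ρ) * Real.exp (-(k ^ 2 / ρ))) := by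
      rw [exp_mul_exp_neg_sq k q hρ, Real.sq_sqrt hρ.le, levyPDF]
      ring

/-- A primitive on `(0, ∞)` of `ρ ↦ exp (-q ^ 2 * ρ) * levyPDF k ρ`, extended by its limit `0`
at the origin, where `k / √ρ` takes a junk value. -/
def levyPrimitive (k q : ℝ) : ℝ → ℝ :=
  (Ioi 0).indicator fun ρ => (erfcTilt k q ρ + erfcTilt k (-q) ρ) / 2

lemma levyPrimitive_of_pos (k q : ℝ) {ρ : ℝ} (hρ : 0 < ρ) :
    levyPrimitive k q ρ = (erfcTilt k q ρ + erfcTilt k (-q) ρ) / 2 :=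
  indicator_of_mem (mem_Ioi.2 hρ) _

lemma levyPrimitive_zero_right (k : ℝ) {ρ : ℝ} (hρ : 0 < ρ) :
    levyPrimitive k 0 ρ = erfc (k / √ρ) := by
  simp [levyPrimitive_of_pos k 0 hρ, erfcTilt]

lemma hasDerivAt_levyPrimitive (k q : ℝ) {ρ : ℝ} (hρ : 0 < ρ) :
    HasDerivAt (levyPrimitive k q) (Real.exp (-(q ^ 2 * ρ)) * levyPDF k ρ) ρ := by
  have hderiv := ((hasDerivAt_erfcTilt k q hρ).add (hasDerivAt_erfcTilt k (-q) hρ)).div_const 2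
  refine (hderiv.congr_of_eventuallyEq ?_).congr_deriv ?_
  · filter_upwards [lt_mem_nhds hρ] with x hx using levyPrimitive_of_pos k q hx
  · rw [neg_sq]
    ring

lemma tendsto_const_div_sqrt_nhdsGT_zero {k : ℝ} (hk : 0 < k) :
    Tendsto (fun ρ : ℝ => k / √ρ) (𝓝[>] 0) atTop := by
  have hsqrt : Tendsto (fun ρ : ℝ => √ρ) (𝓝[>] 0) (𝓝[>] 0) := by
    refine tendsto_nhdsWithin_iff.2 ⟨?_, ?_⟩
    · simpa using (Real.continuous_sqrt.tendsto 0).mono_left (nhdsWithin_le_nhds (s := Ioi 0))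
    · filter_upwards [self_mem_nhdsWithin] with ρ hρ using Real.sqrt_pos.2 hρ
  exact hsqrt.inv_tendsto_nhdsGT_zero.const_mul_atTop hk

lemma tendsto_erfcTilt_nhdsGT_zero {k : ℝ} (hk : 0 < k) (q : ℝ) :
    Tendsto (erfcTilt k q) (𝓝[>] 0) (𝓝 0) := by
  have hlin : Tendsto (fun ρ : ℝ => q * √ρ) (𝓝[>] 0) (𝓝 0) := by
    have hcont : Continuous fun ρ : ℝ => q * √ρ := by fun_prop
    simpa using (hcont.tendsto 0).mono_left (nhdsWithin_le_nhds (s := Ioi 0))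
  have hlim := (tendsto_erfc_atTop.comp
    ((tendsto_const_div_sqrt_nhdsGT_zero hk).atTop_add hlin)).const_mul (Real.exp (2 * k * q))
  rwa [mul_zero] at hlim

lemma continuousWithinAt_levyPrimitive {k : ℝ} (hk : 0 < k) (q : ℝ) :
    ContinuousWithinAt (levyPrimitive k q) (Ici 0) 0 := by
  rw [← continuousWithinAt_Ioi_iff_Ici, ContinuousWithinAt]
  have hlim := ((tendsto_erfcTilt_nhdsGT_zero hk q).add
    (tendsto_erfcTilt_nhdsGT_zero hk (-q))).div_const 2
  have hzero : levyPrimitive k q 0 = (0 + 0) / 2 := by simp [levyPrimitive]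
  rw [hzero]
  refine hlim.congr' ?_
  filter_upwards [self_mem_nhdsWithin] with ρ hρ using (levyPrimitive_of_pos k q hρ).symm

lemma tendsto_erfcTilt_atTop_of_pos (k : ℝ) {q : ℝ} (hq : 0 < q) :
    Tendsto (erfcTilt k q) atTop (𝓝 0) := by
  have hlim := (tendsto_erfc_atTop.comp ((Real.tendsto_sqrt_atTop.const_div_atTop k).add_atTop
    (Real.tendsto_sqrt_atTop.const_mul_atTop hq))).const_mul (Real.exp (2 * k * q))
  rwa [mul_zero] at hlim

lemma tendsto_erfcTilt_atTop_of_neg (k : ℝ) {q : ℝ} (hq : q < 0) :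
    Tendsto (erfcTilt k q) atTop (𝓝 (Real.exp (2 * k * q) * 2)) :=
  (tendsto_erfc_atBot.comp ((Real.tendsto_sqrt_atTop.const_div_atTop k).add_atBot
    (Real.tendsto_sqrt_atTop.const_mul_atTop_of_neg hq))).const_mul _

lemma tendsto_levyPrimitive_atTop (k : ℝ) {q : ℝ} (hq : 0 ≤ q) :
    Tendsto (levyPrimitive k q) atTop (𝓝 (Real.exp (-(2 * k * q)))) := by
  rcases hq.eq_or_lt with rfl | hq
  · have hlim := (hasDerivAt_erfc 0).continuousAt.tendsto.comp
      (Real.tendsto_sqrt_atTop.const_div_atTop k)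
    rw [erfc_zero] at hlim
    simp only [mul_zero, neg_zero, Real.exp_zero]
    refine hlim.congr' ?_
    filter_upwards [eventually_gt_atTop 0] with ρ hρ using (levyPrimitive_zero_right k hρ).symm
  · have hlim := ((tendsto_erfcTilt_atTop_of_pos k hq).add
      (tendsto_erfcTilt_atTop_of_neg k (neg_neg_of_pos hq))).div_const 2
    rw [zero_add, mul_div_cancel_right₀ _ two_ne_zero, mul_neg] at hlim
    refine hlim.congr' ?_
    filter_upwards [eventually_gt_atTop 0] with ρ hρ using (levyPrimitive_of_pos k q hρ).symm

end LevyPrimitive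

section LevyMeasure

variable {k : ℝ}

lemma integrableOn_exp_mul_levyPDF (hk : 0 < k) {q : ℝ} (hq : 0 ≤ q) :
    IntegrableOn (fun ρ => Real.exp (-(q ^ 2 * ρ)) * levyPDF k ρ) (Ioi 0) :=
  integrableOn_Ioi_deriv_of_nonneg (continuousWithinAt_levyPrimitive hk q)
    (fun _ hρ => hasDerivAt_levyPrimitive k q hρ)
    (fun _ hρ => mul_nonneg (Real.exp_nonneg _) (levyPDF_nonneg hk.le (le_of_lt hρ)))
    (tendsto_levyPrimitive_atTop k hq)

lemma integral_exp_mul_levyPDF (hk : 0 < k) {q : ℝ} (hq : 0 ≤ q) :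
    ∫ ρ in Ioi 0, Real.exp (-(q ^ 2 * ρ)) * levyPDF k ρ = Real.exp (-(2 * k * q)) := by
  rw [integral_Ioi_of_hasDerivAt_of_nonneg (continuousWithinAt_levyPrimitive hk q)
    (fun _ hρ => hasDerivAt_levyPrimitive k q hρ)
    (fun _ hρ => mul_nonneg (Real.exp_nonneg _) (levyPDF_nonneg hk.le (le_of_lt hρ)))
    (tendsto_levyPrimitive_atTop k hq)]
  simp [levyPrimitive]

lemma integrableOn_levyPDF (hk : 0 < k) : IntegrableOn (levyPDF k) (Ioi 0) := by
  simpa using integrableOn_exp_mul_levyPDF hk le_rfl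

lemma integrableOn_exp_neg_mul_levyPDF (hk : 0 < k) {T : ℝ → ℝ} (hT : Measurable T) {r : ℝ}
    (hr : 0 ≤ r) (hT0 : ∀ ρ ∈ Ioi r, 0 ≤ T ρ) :
    IntegrableOn (fun ρ => Real.exp (-T ρ) * levyPDF k ρ) (Ioi r) := by
  refine ((integrableOn_levyPDF hk).mono_set (Ioi_subset_Ioi hr)).bdd_mul (c := 1)
    (Measurable.aestronglyMeasurable (by fun_prop)) ?_
  filter_upwards [ae_restrict_mem measurableSet_Ioi] with ρ hρ
  rw [Real.norm_eq_abs, Real.abs_exp, Real.exp_le_one_iff, neg_nonpos]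
  exact hT0 ρ hρ

lemma integral_Ioi_levyPDF (hk : 0 < k) {ρ : ℝ} (hρ : 0 < ρ) :
    ∫ x in Ioi ρ, levyPDF k x = 1 - erfc (k / √ρ) := by
  have hderiv (x : ℝ) (hx : x ∈ Ici ρ) : HasDerivAt (levyPrimitive k 0) (levyPDF k x) x := by
    simpa using hasDerivAt_levyPrimitive k 0 (hρ.trans_le hx)
  rw [integral_Ioi_of_hasDerivAt_of_nonneg' hderiv
    (fun x hx => levyPDF_nonneg hk.le (hρ.trans hx).le)
    (tendsto_levyPrimitive_atTop k le_rfl), levyPrimitive_zero_right k hρ]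
  simp

/-- The Lévy distribution, normalized as in `levyPDF`. -/
def levyMeasure (k : ℝ) : Measure ℝ :=
  (volume.restrict (Ioi 0)).withDensity fun ρ => ENNReal.ofReal (levyPDF k ρ)

lemma ae_levyMeasure_pos (k : ℝ) : ∀ᵐ ρ ∂levyMeasure k, 0 < ρ :=
  (withDensity_absolutelyContinuous _ _).ae_le (ae_restrict_mem measurableSet_Ioi)

lemma setLIntegral_Ioi_levyMeasure (hk : 0 ≤ k) {F : ℝ → ℝ} (hF : Measurable F)
    (hF0 : ∀ ρ, 0 ≤ F ρ) {r : ℝ} (hr : 0 ≤ r)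
    (hint : IntegrableOn (fun ρ => F ρ * levyPDF k ρ) (Ioi r)) :
    ∫⁻ ρ in Ioi r, ENNReal.ofReal (F ρ) ∂levyMeasure k
      = ENNReal.ofReal (∫ ρ in Ioi r, F ρ * levyPDF k ρ) := by
  have hsub : Ioi r ⊆ Ioi (0 : ℝ) := Ioi_subset_Ioi hr
  rw [levyMeasure, restrict_withDensity measurableSet_Ioi,
    Measure.restrict_restrict measurableSet_Ioi, inter_eq_left.2 hsub,
    lintegral_withDensity_eq_lintegral_mul _ (by fun_prop) hF.ennreal_ofReal,
    ofReal_integral_eq_lintegral_ofReal hint]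
  · refine lintegral_congr fun ρ => ?_
    rw [Pi.mul_apply, mul_comm, ENNReal.ofReal_mul (hF0 ρ)]
  · filter_upwards [ae_restrict_mem measurableSet_Ioi] with ρ hρ
    exact mul_nonneg (hF0 ρ) (levyPDF_nonneg hk (le_of_lt (hsub hρ)))

lemma lintegral_exp_levyMeasure (hk : 0 < k) {q : ℝ} (hq : 0 ≤ q) :
    ∫⁻ ρ, ENNReal.ofReal (Real.exp (-(q ^ 2 * ρ))) ∂levyMeasure k
      = ENNReal.ofReal (Real.exp (-(2 * k * q))) := by
  rw [← integral_exp_mul_levyPDF hk hq, ← setLIntegral_Ioi_levyMeasure hk.le (by fun_prop)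
    (fun _ => Real.exp_nonneg _) le_rfl (integrableOn_exp_mul_levyPDF hk hq),
    Measure.restrict_eq_self_of_ae_mem (s := Ioi 0) (ae_levyMeasure_pos k)]

lemma isProbabilityMeasure_levyMeasure (hk : 0 < k) : IsProbabilityMeasure (levyMeasure k) :=
  ⟨by simpa using lintegral_exp_levyMeasure hk le_rfl⟩

lemma levyMeasure_real_Iic (hk : 0 < k) {ρ : ℝ} (hρ : 0 < ρ) :
    (levyMeasure k).real (Iic ρ) = erfc (k / √ρ) := by
  have := isProbabilityMeasure_levyMeasure hk
  have htail : (levyMeasure k).real (Ioi ρ) = 1 - erfc (k / √ρ) := by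
    have hmass := setLIntegral_Ioi_levyMeasure hk.le (F := fun _ => 1) measurable_const
      (fun _ => zero_le_one) hρ.le
      (by simpa using (integrableOn_levyPDF hk).mono_set (Ioi_subset_Ioi hρ.le))
    simp only [one_mul, ENNReal.ofReal_one, setLIntegral_one] at hmass
    rw [measureReal_def, hmass, ENNReal.toReal_ofReal, integral_Ioi_levyPDF hk hρ]
    exact setIntegral_nonneg measurableSet_Ioi fun x hx =>
      levyPDF_nonneg hk.le (hρ.trans hx).le
  rw [← compl_Ioi, probReal_compl_eq_one_sub measurableSet_Ioi, htail, sub_sub_cancel]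

lemma hasLaw_toReal_levyMeasure {Ω : Type*} [MeasurableSpace Ω] {Pr : Measure Ω}
    [IsFiniteMeasure Pr] (hk : 0 < k) {S : Ω → ℝ≥0∞} (hS : Measurable S)
    (hlaplace : ∀ n : ℕ, ∫⁻ w, negExp (S w * n) ∂Pr
      = ENNReal.ofReal (Real.exp (-(2 * k * √n)))) :
    (∀ᵐ w ∂Pr, S w ≠ ∞) ∧ HasLaw (fun w => (S w).toReal) (levyMeasure k) Pr := by
  have := isProbabilityMeasure_levyMeasure hk
  have hmap : Pr.map S = (levyMeasure k).map ENNReal.ofReal := by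
    refine ext_of_lintegral_negExp_mul_natCast fun n => ?_
    rw [lintegral_map (by fun_prop) hS, hlaplace, lintegral_map (by fun_prop) (by fun_prop),
      ← lintegral_exp_levyMeasure hk (Real.sqrt_nonneg n)]
    refine lintegral_congr_ae ?_
    filter_upwards [ae_levyMeasure_pos k] with ρ hρ
    rw [← ENNReal.ofReal_natCast, ← ENNReal.ofReal_mul hρ.le, negExp_ofReal (by positivity),
      Real.sq_sqrt n.cast_nonneg, mul_comm]
  refine ⟨ae_of_ae_map (p := (· ≠ ∞)) hS.aemeasurable ?_, by fun_prop, ?_⟩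
  · rw [hmap]
    exact (ae_map_iff (by fun_prop) (measurableSet_singleton ∞).compl).2
      (ae_of_all _ fun _ => ENNReal.ofReal_ne_top)
  · change Pr.map (ENNReal.toReal ∘ S) = _
    rw [← Measure.map_map (by fun_prop) hS, hmap, Measure.map_map (by fun_prop) (by fun_prop)]
    refine (Measure.map_congr ?_).trans Measure.map_id
    filter_upwards [ae_levyMeasure_pos k] with ρ hρ using ENNReal.toReal_ofReal hρ.le

end LevyMeasure

/-! ### The law of the incident power -/

section ExtendedPower

variable {Ω : Type*}

/-- The incident power as a sum in `[0, ∞]`, which is defined without any convergence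
assumption and agrees with `incidentPower` when the gains are nonnegative. -/
def extendedPower (PA μ : ℝ) (xS : Plane) (X : ℕ → Ω → Plane) (c : ℕ → Ω → Bool)
    (h : ℕ → Ω → ℝ) (w : Ω) : ℝ≥0∞ :=
  ∑' a, if c a w = true then ENNReal.ofReal (PA * receivedGain μ xS X h w a) else 0

variable {X : ℕ → Ω → Plane} {c : ℕ → Ω → Bool} {h : ℕ → Ω → ℝ} {PA : ℝ}

lemma measurable_extendedPower [MeasurableSpace Ω] (PA μ : ℝ) (xS : Plane)
    (hX : ∀ a, Measurable (X a)) (hc : ∀ a, Measurable (c a)) (hh : ∀ a, Measurable (h a)) :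
    Measurable (extendedPower PA μ xS X c h) := by
  refine Measurable.tsum fun a => measurable_ite_eq_true (hc a) ?_
  have := hX a
  have := hh a
  unfold receivedGain
  fun_prop

lemma extendedPower_term_ne_top (PA μ : ℝ) (xS : Plane) (w : Ω) (a : ℕ) :
    (if c a w = true then ENNReal.ofReal (PA * receivedGain μ xS X h w a) else 0) ≠ ∞ := by
  split_ifs <;> simp

lemma toReal_extendedPower_term (hPA : 0 ≤ PA) (μ : ℝ) (xS : Plane) {w : Ω} {a : ℕ}
    (hh : 0 ≤ h a w) :
    (if c a w = true then ENNReal.ofReal (PA * receivedGain μ xS X h w a) else 0).toReal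
      = PA * {a | c a w = true}.indicator (receivedGain μ xS X h w) a := by
  have hgain : 0 ≤ receivedGain μ xS X h w a := by
    unfold receivedGain
    positivity
  by_cases hca : c a w = true <;> simp [hca, mul_nonneg hPA hgain]

lemma summable_receivedGain (hPA : 0 < PA) (μ : ℝ) (xS : Plane) {w : Ω} (hh : ∀ a, 0 ≤ h a w)
    (hfin : extendedPower PA μ xS X c h w ≠ ∞) :
    Summable fun a : {a : ℕ // c a w = true} => receivedGain μ xS X h w a := by
  refine (summable_subtype_iff_indicator (f := receivedGain μ xS X h w)
    (s := {a | c a w = true})).2 ?_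
  refine (summable_mul_left_iff hPA.ne').1 ((ENNReal.summable_toReal hfin).congr fun a => ?_)
  exact toReal_extendedPower_term hPA.le μ xS (hh a)

lemma toReal_extendedPower (hPA : 0 ≤ PA) (μ : ℝ) (xS : Plane) {w : Ω} (hh : ∀ a, 0 ≤ h a w) :
    (extendedPower PA μ xS X c h w).toReal = incidentPower PA μ xS X c h w := by
  rw [extendedPower, ENNReal.tsum_toReal_eq (extendedPower_term_ne_top PA μ xS w), incidentPower]
  simp_rw [toReal_extendedPower_term hPA μ xS (hh _)]
  rw [tsum_mul_left]
  exact congrArg (PA * ·) (tsum_subtype {a | c a w = true} (receivedGain μ xS X h w)).symm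

end ExtendedPower

section IncidentPower

/-- The parameter of the Lévy law of the incident power in a field of active transmitters of
density `ζ` and power `PA`. -/
def levyScale (ζ PA : ℝ) : ℝ := ζ * √PA * Real.pi ^ 2 / 4

lemma levyScale_pos {ζ PA : ℝ} (hζ : 0 < ζ) (hPA : 0 < PA) : 0 < levyScale ζ PA := by
  have := Real.pi_pos
  unfold levyScale
  positivity

lemma cdfPI_eq_erfc (ζ PA ρ : ℝ) : cdfPI ζ PA ρ = erfc (levyScale ζ PA / √ρ) := by
  rw [cdfPI, levyScale, div_div]

lemma pdfPI_eq_levyPDF (ζ : ℝ) {PA : ℝ} (hPA : 0 ≤ PA) {ρ : ℝ} (hρ : 0 < ρ) :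
    pdfPI ζ PA ρ = levyPDF (levyScale ζ PA) ρ := by
  have hpow : (Real.pi / ρ) ^ (3 / 2 : ℝ) = √Real.pi ^ 3 / (ρ * √ρ) := by
    rw [show (3 / 2 : ℝ) = 1 + 1 / 2 by norm_num, Real.rpow_add (div_pos Real.pi_pos hρ),
      Real.rpow_one, ← Real.sqrt_eq_rpow, Real.sqrt_div Real.pi_pos.le, pow_succ,
      Real.sq_sqrt Real.pi_pos.le]
    ring
  have hexp : levyScale ζ PA ^ 2 / ρ = Real.pi ^ 4 * ζ ^ 2 * PA / (16 * ρ) := by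
    rw [levyScale, div_pow, mul_pow, mul_pow, Real.sq_sqrt hPA]
    field_simp
    ring
  have hpi : Real.pi ^ 2 = √Real.pi ^ 4 := by
    rw [show 4 = 2 * 2 from rfl, pow_mul, Real.sq_sqrt Real.pi_pos.le]
  rw [pdfPI, levyPDF, hexp, hpow, levyScale, hpi]
  field_simp

variable {Ω : Type*} [MeasurableSpace Ω] {Pr : Measure Ω} {X : ℕ → Ω → Plane} {c : ℕ → Ω → Bool}
  {h : ℕ → Ω → ℝ} {g : Ω → ℝ} {ζ l lam PA : ℝ}

lemma levyMeasure_levyScale (ζ : ℝ) (hPA : 0 ≤ PA) :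
    levyMeasure (levyScale ζ PA) = (volume.restrict (Ioi (0 : ℝ))).withDensity
      fun ρ => ENNReal.ofReal (pdfPI ζ PA ρ) := by
  refine withDensity_congr_ae ?_
  filter_upwards [ae_restrict_mem measurableSet_Ioi] with ρ hρ
  rw [pdfPI_eq_levyPDF ζ hPA hρ]

lemma measureReal_le_eq_cdfPI (hζ : 0 < ζ) (hPA : 0 < PA) {PI : Ω → ℝ}
    (hPI : HasLaw PI (levyMeasure (levyScale ζ PA)) Pr) {ρ : ℝ} (hρ : 0 < ρ) :
    Pr.real {w | PI w ≤ ρ} = cdfPI ζ PA ρ := by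
  rw [cdfPI_eq_erfc, ← levyMeasure_real_Iic (levyScale_pos hζ hPA) hρ]
  exact hPI.measureReal_eq (p := (· ≤ ρ)) measurableSet_Iic

namespace IsNetwork

lemma ae_gain_nonneg (hnet : IsNetwork X c h g ζ l lam Pr) : ∀ᵐ w ∂Pr, ∀ a, 0 ≤ h a w := by
  refine ae_all_iff.2 fun a => ((hnet.law_h a).ae_iff measurableSet_Ici.mem).2 ?_
  change ∀ᵐ y ∂volume.withDensity (exponentialPDF 1), y ∈ Ici 0
  exact (ae_withDensity_iff (measurable_exponentialPDFReal 1).ennreal_ofReal).2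
    (ae_of_all _ fun y hpdf => not_lt.1 fun hneg => hpdf (exponentialPDF_of_neg hneg))

lemma measurable_extendedPower (hnet : IsNetwork X c h g ζ l lam Pr) (PA μ : ℝ) (xS : Plane) :
    Measurable (extendedPower PA μ xS X c h) :=
  HybridD2D.measurable_extendedPower PA μ xS hnet.poisson.measurable hnet.measurable_c
    hnet.measurable_h

lemma incidentPower_ae_eq (hnet : IsNetwork X c h g ζ l lam Pr) (hPA : 0 ≤ PA) (μ : ℝ)
    (xS : Plane) :
    incidentPower PA μ xS X c h =ᵐ[Pr] fun w => (extendedPower PA μ xS X c h w).toReal := by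
  filter_upwards [hnet.ae_gain_nonneg] with w hw using (toReal_extendedPower hPA μ xS hw).symm

variable [IsProbabilityMeasure Pr]

lemma indepFun_incidentPower (hnet : IsNetwork X c h g ζ l lam Pr) (hPA : 0 ≤ PA) (μ : ℝ)
    (xS : Plane) : IndepFun (incidentPower PA μ xS X c h) g Pr := by
  have mX : Measurable fun w a => X a w := measurable_pi_lambda _ hnet.poisson.measurable
  have mc : Measurable fun w a => c a w := measurable_pi_lambda _ hnet.measurable_c
  have mh : Measurable fun w a => h a w := measurable_pi_lambda _ hnet.measurable_h
  have hindep : IndepFun (fun w => ((fun a => X a w, fun a => c a w), fun a => h a w)) g Pr :=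
    indepFun_prodMk_left (mX.prodMk mc) mh hnet.measurable_g
      (indepFun_prodMk_left mX mc (mh.prodMk hnet.measurable_g) hnet.indep_X hnet.indep_c_hg)
      hnet.indep_h_g
  have mpower : Measurable (extendedPower PA μ xS
      (fun a (p : ((ℕ → Plane) × (ℕ → Bool)) × (ℕ → ℝ)) => p.1.1 a) (fun a p => p.1.2 a)
      fun a p => p.2 a) :=
    HybridD2D.measurable_extendedPower PA μ xS (by fun_prop) (by fun_prop) (by fun_prop)
  exact (hindep.comp mpower.ennreal_toReal measurable_id).congr
    (hnet.incidentPower_ae_eq hPA μ xS).symm ae_eq_rfl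

lemma lintegral_negExp_extendedPower (hnet : IsNetwork X c h g ζ l lam Pr) (hζ : 0 ≤ ζ)
    (hl : 0 ≤ l) (hPA : 0 ≤ PA) (xS : Plane) (n : ℕ) :
    ∫⁻ w, negExp (extendedPower PA 4 xS X c h w * n) ∂Pr
      = ENNReal.ofReal (Real.exp (-(2 * levyScale (l * ζ) PA * √n))) := by
  have hsum (w : Ω) : extendedPower PA 4 xS X c h w * n = ∑' a, if c a w = true then
      ENNReal.ofReal (h a w * (n * PA * ‖X a w - xS‖ ^ (-4 : ℝ))) else 0 := by
    rw [extendedPower, ← ENNReal.tsum_mul_right]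
    refine tsum_congr fun a => ?_
    rw [ite_mul, zero_mul, ← ENNReal.ofReal_natCast, ← ENNReal.ofReal_mul' n.cast_nonneg,
      receivedGain]
    ring_nf
  simp_rw [hsum]
  rw [hnet.lintegral_negExp_tsum_active hl (ℓ := fun x => n * PA * ‖x - xS‖ ^ (-4 : ℝ))
    (by fun_prop) fun x => by positivity]
  simp_rw [ENNReal.ofReal_mul hl]
  rw [lintegral_const_mul _ (by fun_prop), lintegral_pathGain_div_one_add (by positivity),
    ← ENNReal.ofReal_mul hl, ← ENNReal.ofReal_mul hζ, negExp_ofReal (by positivity),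
    Real.sqrt_mul n.cast_nonneg, levyScale]
  ring_nf

lemma ae_summable_receivedGain (hnet : IsNetwork X c h g ζ l lam Pr) (hζ : 0 < ζ) (hl : 0 < l)
    (hPA : 0 < PA) (xS : Plane) :
    ∀ᵐ w ∂Pr, Summable fun a : {a : ℕ // c a w = true} => receivedGain 4 xS X h w a := by
  have hfin := (hasLaw_toReal_levyMeasure (levyScale_pos (mul_pos hl hζ) hPA)
    (hnet.measurable_extendedPower PA 4 xS)
    (hnet.lintegral_negExp_extendedPower hζ.le hl.le hPA.le xS)).1
  filter_upwards [hfin, hnet.ae_gain_nonneg] with w hw hgain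
  exact summable_receivedGain hPA 4 xS hgain hw

lemma hasLaw_incidentPower (hnet : IsNetwork X c h g ζ l lam Pr) (hζ : 0 < ζ) (hl : 0 < l)
    (hPA : 0 < PA) (xS : Plane) :
    HasLaw (incidentPower PA 4 xS X c h) (levyMeasure (levyScale (l * ζ) PA)) Pr :=
  (hasLaw_toReal_levyMeasure (levyScale_pos (mul_pos hl hζ) hPA)
    (hnet.measurable_extendedPower PA 4 xS)
    (hnet.lintegral_negExp_extendedPower hζ.le hl.le hPA.le xS)).2.congr
    (hnet.incidentPower_ae_eq hPA.le 4 xS)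

end IsNetwork

end IncidentPower

/-! ### Energy outage -/

section EnergyOutage

lemma setOf_harvestB_le {Ω : Type*} {β ϱ : ℝ} (hβϱ : 0 < β * ϱ) (ρB : ℝ) (PI : Ω → ℝ) :
    {w | harvestB β ϱ PI w ≤ ρB} = {w | PI w ≤ ρB / (β * ϱ)} := by
  ext w
  exact (le_div_iff₀' hβϱ).symm

lemma setOf_harvestH_le {Ω : Type*} {ω β : ℝ} (hωβ : 0 < ω * β) (ρH : ℝ) (PI : Ω → ℝ) :
    {w | harvestH ω β PI w ≤ ρH} = {w | PI w ≤ ρH / (ω * β)} := by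
  ext w
  exact (le_div_iff₀' hωβ).symm

/-- The link gain above which backscattering at incident power `ρ` has a signal-to-noise ratio
larger than `τB`. -/
def linkThreshold (δ ϱ d μ σ τB ρ : ℝ) : ℝ := τB * d ^ μ * σ ^ 2 / (δ * ρ * (1 - ϱ))

variable {β ϱ δ σ ρB d τB : ℝ}

lemma mul_linkThreshold (lam δ ϱ d μ σ τB ρ : ℝ) :
    lam * linkThreshold δ ϱ d μ σ τB ρ = lam * τB * d ^ μ * σ ^ 2 / (δ * ρ * (1 - ϱ)) := by
  rw [linkThreshold]
  ring

@[fun_prop]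
lemma measurable_linkThreshold (δ ϱ d μ σ τB : ℝ) :
    Measurable (linkThreshold δ ϱ d μ σ τB) := by
  unfold linkThreshold
  fun_prop

lemma linkThreshold_nonneg (hϱ1 : ϱ ≤ 1) (hδ : 0 ≤ δ) (hd : 0 ≤ d) (μ σ : ℝ) (hτB : 0 ≤ τB)
    {ρ : ℝ} (hρ : 0 ≤ ρ) : 0 ≤ linkThreshold δ ϱ d μ σ τB ρ := by
  have : 0 ≤ 1 - ϱ := sub_nonneg.2 hϱ1
  unfold linkThreshold
  positivity

lemma lt_snrB_and_lt_harvestB_iff {Ω : Type*} (hβϱ : 0 < β * ϱ) (hϱ1 : ϱ < 1) (hδ : 0 < δ)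
    (hσ : 0 < σ) (hρB : 0 ≤ ρB) (hd : 0 < d) (μ τB : ℝ) (PI g : Ω → ℝ) (w : Ω) :
    (τB < snrB δ β ϱ ρB d μ σ PI g w ∧ ρB < harvestB β ϱ PI w) ↔
      (PI w ∈ Ioi (ρB / (β * ϱ)) ∧ linkThreshold δ ϱ d μ σ τB (PI w) < g w) := by
  have hharvest : ρB < harvestB β ϱ PI w ↔ ρB / (β * ϱ) < PI w := (div_lt_iff₀' hβϱ).symm
  rw [and_comm, hharvest, mem_Ioi]
  refine and_congr_right fun hlt => ?_
  have hPI : 0 < PI w := lt_of_le_of_lt (by positivity) hlt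
  have : 0 < 1 - ϱ := sub_pos.2 hϱ1
  rw [linkThreshold, snrB, backscatterPower, if_pos (hharvest.2 hlt), Real.rpow_neg hd.le,
    lt_div_iff₀ (by positivity), div_lt_iff₀ (by positivity), ← div_eq_mul_inv,
    lt_div_iff₀ (Real.rpow_pos_of_pos hd μ)]
  ring_nf

lemma expMeasure_Ioi {r x : ℝ} (hr : 0 < r) (hx : 0 ≤ x) :
    expMeasure r (Ioi x) = ENNReal.ofReal (Real.exp (-(r * x))) := by
  have := isProbabilityMeasure_expMeasure hr
  have hcdf : (expMeasure r).real (Iic x) = 1 - Real.exp (-(r * x)) := by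
    rw [← cdf_eq_real, cdf_expMeasure_eq hr, if_pos hx]
  rw [← compl_Iic, ← ofReal_measureReal, probReal_compl_eq_one_sub measurableSet_Iic, hcdf,
    sub_sub_cancel]

variable {Ω : Type*} [MeasurableSpace Ω] {Pr : Measure Ω} [IsFiniteMeasure Pr] {lam : ℝ}

lemma measure_mem_and_lt {E : Type*} [MeasurableSpace E] {κ : Measure E} {Q : Ω → E} {g : Ω → ℝ}
    (hQ : HasLaw Q κ Pr) (hg : HasLaw g (expMeasure lam) Pr) (hlam : 0 < lam)
    (hindep : IndepFun Q g Pr) {A : Set E} (hA : MeasurableSet A) {T : E → ℝ} (hT : Measurable T)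
    (hT0 : ∀ x ∈ A, 0 ≤ T x) :
    Pr {w | Q w ∈ A ∧ T (Q w) < g w}
      = ∫⁻ x in A, ENNReal.ofReal (Real.exp (-(lam * T x))) ∂κ := by
  have := isProbabilityMeasure_expMeasure hlam
  have hmeas : MeasurableSet {p : E × ℝ | p.1 ∈ A ∧ T p.1 < p.2} :=
    (hA.mem.comp measurable_fst).setOf.inter (measurableSet_lt (by fun_prop) measurable_snd)
  have hjoint := hindep.hasLaw_prod hQ hg
  change Pr ((fun w => (Q w, g w)) ⁻¹' {p : E × ℝ | p.1 ∈ A ∧ T p.1 < p.2}) = _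
  rw [← Measure.map_apply_of_aemeasurable hjoint.aemeasurable hmeas, hjoint.map_eq,
    Measure.prod_apply hmeas, ← lintegral_indicator hA]
  refine lintegral_congr fun x => ?_
  by_cases hx : x ∈ A
  · rw [indicator_of_mem hx, ← expMeasure_Ioi hlam (hT0 x hx)]
    congr 1
    ext y
    simp [hx]
  · simp [hx]

variable {ζ PA : ℝ}

lemma integrableOn_exp_linkThreshold_mul_pdfPI (hζ : 0 < ζ) (hPA : 0 < PA) (hlam : 0 ≤ lam)
    (hϱ1 : ϱ ≤ 1) (hδ : 0 ≤ δ) (hd : 0 ≤ d) (μ σ : ℝ) (hτB : 0 ≤ τB) {r : ℝ} (hr : 0 ≤ r) :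
    IntegrableOn (fun ρ => Real.exp (-(lam * linkThreshold δ ϱ d μ σ τB ρ)) * pdfPI ζ PA ρ)
      (Ioi r) := by
  refine (integrableOn_exp_neg_mul_levyPDF (levyScale_pos hζ hPA)
    (T := fun ρ => lam * linkThreshold δ ϱ d μ σ τB ρ) (by fun_prop) hr fun ρ hρ => mul_nonneg hlam
      (linkThreshold_nonneg hϱ1 hδ hd μ σ hτB (hr.trans_lt hρ).le)).congr_fun
    (fun ρ hρ => ?_) measurableSet_Ioi
  rw [pdfPI_eq_levyPDF ζ hPA.le (hr.trans_lt hρ)]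

lemma selectSTP_eq_integral {PI g : Ω → ℝ} (hζ : 0 < ζ) (hPA : 0 < PA)
    (hPI : HasLaw PI (levyMeasure (levyScale ζ PA)) Pr) (hg : HasLaw g (expMeasure lam) Pr)
    (hlam : 0 < lam) (hindep : IndepFun PI g Pr) (hβϱ : 0 < β * ϱ) (hϱ1 : ϱ < 1) (hδ : 0 < δ)
    (hσ : 0 < σ) (hρB : 0 ≤ ρB) (hd : 0 < d) (hτB : 0 ≤ τB) (μ : ℝ) :
    selectSTP δ β ϱ ρB d μ σ τB PI g Pr = ∫ ρ in Ioi (ρB / (β * ϱ)),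
      Real.exp (-(lam * linkThreshold δ ϱ d μ σ τB ρ)) * pdfPI ζ PA ρ := by
  have hr : 0 ≤ ρB / (β * ϱ) := by positivity
  have hpdf : EqOn (fun ρ => Real.exp (-(lam * linkThreshold δ ϱ d μ σ τB ρ)) * pdfPI ζ PA ρ)
      (fun ρ => Real.exp (-(lam * linkThreshold δ ϱ d μ σ τB ρ)) * levyPDF (levyScale ζ PA) ρ)
      (Ioi (ρB / (β * ϱ))) := fun ρ hρ =>
    congrArg (_ * ·) (pdfPI_eq_levyPDF ζ hPA.le (hr.trans_lt hρ))
  have hint := (integrableOn_exp_linkThreshold_mul_pdfPI hζ hPA hlam.le hϱ1.le hδ.le hd.le μ σ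
    hτB hr).congr_fun hpdf measurableSet_Ioi
  have hthreshold (ρ : ℝ) (hρ : ρ ∈ Ioi (ρB / (β * ϱ))) :=
    linkThreshold_nonneg hϱ1.le hδ.le hd.le μ σ hτB (hr.trans_lt hρ).le
  simp only [selectSTP, lt_snrB_and_lt_harvestB_iff hβϱ hϱ1 hδ hσ hρB hd, measureReal_def]
  rw [measure_mem_and_lt hPI hg hlam hindep measurableSet_Ioi (by fun_prop) hthreshold,
    setLIntegral_Ioi_levyMeasure (levyScale_pos hζ hPA).le (by fun_prop)
      (fun _ => Real.exp_nonneg _) hr hint, ENNReal.toReal_ofReal,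
    setIntegral_congr_fun measurableSet_Ioi hpdf]
  exact setIntegral_nonneg measurableSet_Ioi fun ρ hρ =>
    mul_nonneg (Real.exp_nonneg _) (levyPDF_nonneg (levyScale_pos hζ hPA).le (hr.trans_lt hρ).le)

end EnergyOutage

end

end HybridD2D

open HybridD2D in
theorem corollary1_general {Ω : Type*} [MeasurableSpace Ω] (Pr : Measure Ω)
    [IsProbabilityMeasure Pr] (X : ℕ → Ω → Plane) (c : ℕ → Ω → Bool) (h : ℕ → Ω → ℝ) (g : Ω → ℝ)
    (xS xD : Plane) (ζA lA lam PA β ϱ ω δ σ ρB ρH τB : ℝ)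
    (hζA : 0 < ζA) (hlA : 0 < lA) (hlam : 0 < lam) (hPA : 0 < PA)
    (hβ : 0 < β) (hϱ : 0 < ϱ) (hϱ1 : ϱ < 1) (hω : 0 < ω)
    (hδ : 0 < δ) (hσ : 0 < σ) (hρB : 0 < ρB) (hρH : 0 < ρH) (hτB : 0 ≤ τB)
    (hxSD : xS ≠ xD)
    (hnet : IsNetwork X c h g ζA lA lam Pr)
    (PI : Ω → ℝ) (hPI : PI = incidentPower PA 4 xS X c h) :
    (∀ᵐ w ∂Pr, Summable
      (fun a : {a : ℕ // c a w = true} => receivedGain 4 xS X h w a)) ∧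
    HasLaw PI ((volume.restrict (Ioi (0 : ℝ))).withDensity
      (fun ρ => ENNReal.ofReal (pdfPI (lA * ζA) PA ρ))) Pr ∧
    (∀ ρ : ℝ, 0 < ρ → Pr.real {w | PI w ≤ ρ} = cdfPI (lA * ζA) PA ρ) ∧
    energyOutage (selectPTP ω β ρH PI Pr) ω β ϱ ρB ρH PI Pr =
      cdfPI (lA * ζA) PA (ρH / (ω * β)) *
        (cdfPI (lA * ζA) PA (ρB / (β * ϱ))
          - cdfPI (lA * ζA) PA (ρH / (ω * β)) + 1) ∧
    IntegrableOn (fun ρ => Real.exp (-(lam * τB * dist xS xD ^ (4 : ℝ) * σ ^ 2 /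
      (δ * ρ * (1 - ϱ)))) * pdfPI (lA * ζA) PA ρ) (Ioi (ρB / (β * ϱ))) ∧
    energyOutage
        (selectSTP δ β ϱ ρB (dist xS xD) 4 σ τB PI g Pr) ω β ϱ ρB ρH PI Pr =
      (∫ ρ in Ioi (ρB / (β * ϱ)), Real.exp (-(lam * τB * dist xS xD ^ (4 : ℝ) * σ ^ 2 /
          (δ * ρ * (1 - ϱ)))) * pdfPI (lA * ζA) PA ρ) *
        (cdfPI (lA * ζA) PA (ρB / (β * ϱ))
          - cdfPI (lA * ζA) PA (ρH / (ω * β)))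
      + cdfPI (lA * ζA) PA (ρH / (ω * β)) := by
  have hζ : 0 < lA * ζA := mul_pos hlA hζA
  have hd : 0 < dist xS xD := dist_pos.2 hxSD
  have hβϱ : 0 < β * ϱ := mul_pos hβ hϱ
  have hωβ : 0 < ω * β := mul_pos hω hβ
  have hlaw : HasLaw PI (levyMeasure (levyScale (lA * ζA) PA)) Pr :=
    hPI ▸ hnet.hasLaw_incidentPower hζA hlA hPA xS
  have hindep : IndepFun PI g Pr := hPI ▸ hnet.indepFun_incidentPower hPA.le 4 xS
  have hcdf (ρ : ℝ) (hρ : 0 < ρ) := measureReal_le_eq_cdfPI hζ hPA hlaw hρ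
  simp_rw [← mul_linkThreshold]
  refine ⟨hnet.ae_summable_receivedGain hζA hlA hPA xS,
    levyMeasure_levyScale (lA * ζA) hPA.le ▸ hlaw, hcdf, ?_,
    integrableOn_exp_linkThreshold_mul_pdfPI hζ hPA hlam.le hϱ1.le hδ.le hd.le 4 σ hτB
      (div_pos hρB hβϱ).le, ?_⟩
  · rw [energyOutage, selectPTP, setOf_harvestB_le hβϱ, setOf_harvestH_le hωβ,
      hcdf _ (div_pos hρB hβϱ), hcdf _ (div_pos hρH hωβ)]
    ring
  · rw [energyOutage, setOf_harvestB_le hβϱ, setOf_harvestH_le hωβ,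
      hcdf _ (div_pos hρB hβϱ), hcdf _ (div_pos hρH hωβ),
      selectSTP_eq_integral hζ hPA hlaw hnet.law_g hlam hindep hβϱ hϱ1 hδ hσ hρB.le hd hτB]
    ring

theorem corollary1 {Ω : Type*} [MeasurableSpace Ω] (Pr : Measure Ω) [IsProbabilityMeasure Pr]
    (X : ℕ → Ω → HybridD2D.Plane) (c : ℕ → Ω → Bool) (h : ℕ → Ω → ℝ) (g : Ω → ℝ)
    (xS xD : HybridD2D.Plane) (ζA lA lam PA β ϱ ω δ σ ρB ρH τB : ℝ)
    (hζA : 0 < ζA) (hlA : 0 < lA) (hlA1 : lA ≤ 1) (hlam : 0 < lam) (hPA : 0 < PA)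
    (hβ : 0 < β) (hβ1 : β ≤ 1) (hϱ : 0 < ϱ) (hϱ1 : ϱ < 1) (hω : 0 < ω) (hω1 : ω < 1)
    (hδ : 0 < δ) (hδ1 : δ ≤ 1) (hσ : 0 < σ) (hρB : 0 < ρB) (hρH : 0 < ρH) (hτB : 0 ≤ τB)
    (hxSD : xS ≠ xD)
    (hnet : HybridD2D.IsNetwork X c h g ζA lA lam Pr)
    (PI : Ω → ℝ) (hPI : PI = HybridD2D.incidentPower PA 4 xS X c h) :
    -- the incident power is almost surely a convergent series
    (∀ᵐ w ∂Pr, Summable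
      (fun a : {a : ℕ // c a w = true} => HybridD2D.receivedGain 4 xS X h w a)) ∧
    -- its law has the explicit density on the positive half-line
    HasLaw PI ((volume.restrict (Ioi (0 : ℝ))).withDensity
      (fun ρ => ENNReal.ofReal (HybridD2D.pdfPI (lA * ζA) PA ρ))) Pr ∧
    -- its distribution function
    (∀ ρ : ℝ, 0 < ρ → Pr.real {w | PI w ≤ ρ} = HybridD2D.cdfPI (lA * ζA) PA ρ) ∧
    -- energy outage probability under the power threshold-based protocol
    HybridD2D.energyOutage (HybridD2D.selectPTP ω β ρH PI Pr) ω β ϱ ρB ρH PI Pr =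
      HybridD2D.cdfPI (lA * ζA) PA (ρH / (ω * β)) *
        (HybridD2D.cdfPI (lA * ζA) PA (ρB / (β * ϱ))
          - HybridD2D.cdfPI (lA * ζA) PA (ρH / (ω * β)) + 1) ∧
    -- energy outage probability under the SNR threshold-based protocol
    IntegrableOn (fun ρ => Real.exp (-(lam * τB * dist xS xD ^ (4 : ℝ) * σ ^ 2 /
      (δ * ρ * (1 - ϱ)))) * HybridD2D.pdfPI (lA * ζA) PA ρ) (Ioi (ρB / (β * ϱ))) ∧
    HybridD2D.energyOutage
        (HybridD2D.selectSTP δ β ϱ ρB (dist xS xD) 4 σ τB PI g Pr) ω β ϱ ρB ρH PI Pr =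
      (∫ ρ in Ioi (ρB / (β * ϱ)), Real.exp (-(lam * τB * dist xS xD ^ (4 : ℝ) * σ ^ 2 /
          (δ * ρ * (1 - ϱ)))) * HybridD2D.pdfPI (lA * ζA) PA ρ) *
        (HybridD2D.cdfPI (lA * ζA) PA (ρB / (β * ϱ))
          - HybridD2D.cdfPI (lA * ζA) PA (ρH / (ω * β)))
      + HybridD2D.cdfPI (lA * ζA) PA (ρH / (ω * β)) :=
  corollary1_general Pr X c h g xS xD ζA lA lam PA β ϱ ω δ σ ρB ρH τB hζA hlA hlam hPA hβ hϱ hϱ1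
    hω hδ hσ hρB hρH hτB hxSD hnet PI hPI
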